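/- **Setting.** Let $\mathcal H$ be a real reproducing kernel Hilbert space on a set $\mathcal X$ with kernel $\mathbb K$, $\mathbb K(z,z)\le 1$ for all $z$. Let $x_1,\dots,x_n\in\mathcal X$ be fixed, and observe $y_i=f^*(x_i)+\overline\varepsilon_i$ with $\|f^*\|_{\mathcal H}\le R$ and $\overline\varepsilon_i$ i.i.d. $\mathcal N(0,\sigma^2)$, where $R,\sigma>0$. Put $\|h\|_n^2=\frac1n\sum_i h(x_i)^2$. Let $K_n=(\mathbb K(x_i,x_j)/n)_{i,j}$ have rank $r$, eigenvalues $\widehat\mu_1\ge\dots\ge\widehat\mu_r>0=\widehat\mu_{r+1}=\dots=\widehat\mu_n$ and orthonormal eigenvectors $\widehat u_i$, and let $Z_i=\langle\widehat u_i,Y\rangle$. Let $g_\lambda$ be a spectral filter: for every $\xi\in(0,1]$, $\lambda\mapsto g_\lambda(\xi)$ is continuous and non-increasing on $(0,\infty)$, $\xi g_\lambda(\xi)\to1$ as $\lambda\to0$, $|g_\lambda(\xi)|\le\overline B/\lambda$, $|\xi g_\lambda(\xi)|\le\overline D$, and $|1-\xi g_\lambda(\xi)|\,\xi^\nu\le C_\nu\lambda^\nu$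 for all $\lambda>0$ and $0<\nu\le\bar\nu$, with qualification $\bar\nu\ge1$. Let $t\mapsto\lambda_t>0$ be continuous and non-increasing on $(0,\infty)$ with $\lambda_t\to0$ as $t\to\infty$. Let $f^t=\frac1n\sum_j (g_{\lambda_t}(K_n)Y)_j\,\mathbb K(\cdot,x_j)$ for $t>0$ (so that $(f^t(x_1),\dots,f^t(x_n))^\top=g_{\lambda_t}(K_n)K_nY$) and $f^0=0$. Put $\gamma_i^{(t)}=\widehat\mu_i g_{\lambda_t}(\widehat\mu_i)$ and assume that, for some $a\in(0,1)$ and $\eta>0$, $a\min\{1,\eta t\widehat\mu_i\}\le\gamma_i^{(t)}\le\min\{1,\eta t\widehat\mu_i\}$ for all $t>0$ and all $i$. For $\alpha>0$ the smoothed rule is $$\tau_\alpha=\inf\Big\{t>0:\ \tfrac1n\sum_{i=1}^r\widehat\mu_i^{\alpha}(1-\gamma_i^{(t)})^2Z_i^2\le\tfrac{\sigma^2}{n}\sum_{i=1}^r\widehat\mu_i^\alpha\Big\}.$$ **Corollary.** Let $\beta>1$, $0<c\le C$, $\alpha\in[\frac1{\beta+1},\frac1\beta)$ and $\rho>0$.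 There are constants $A,b_1,b_2>0$ depending only on $\alpha,\beta,c,C,a,\rho$ and the filter constants $\overline B,\overline D,\bar\nu,(C_\nu)_\nu$ (not on $\mathcal X$, $\mathcal H$, $n$, the design, $\sigma$, $R$, $\eta$, $g$ or $\lambda_t$) such that the following holds in the setting above whenever $c\,i^{-\beta}\le\widehat\mu_i\le C\,i^{-\beta}$ for $i=1,\dots,r$ and $nR^2/\sigma^2\ge\rho$. 1. The rule $\tau_\alpha$ is minimax-rate optimal over the ball: $$\inf_{\widehat f}\sup_{\|f^*\|_{\mathcal H}\le R}\mathbb E_\varepsilon\|\widehat f-f^*\|_n^2\ \le\ \sup_{\|f^*\|_{\mathcal H}\le R}\mathbb E_\varepsilon\|f^{\tau_\alpha}-f^*\|_n^2\ \le\ A\,\inf_{\widehat f}\sup_{\|f^*\|_{\mathcal H}\le R}\mathbb E_\varepsilon\|\widehat f-f^*\|_n^2,$$ where the infimum is over all measurable functions of the data. 2. If moreover $r^{\beta+1}\ge\rho\, nR^2/\sigma^2$, then $$b_1R^2\Big(\frac{\sigma^2}{R^2n}\Big)^{\frac{\beta}{\beta+1}}\le\inf_{\widehat f}\sup_{\|f^*\|_{\mathcal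 H}\le R}\mathbb E_\varepsilon\|\widehat f-f^*\|_n^2\le b_2R^2\Big(\frac{\sigma^2}{R^2n}\Big)^{\frac{\beta}{\beta+1}}.$$ For fixed $\sigma$ and $R$ and full-rank kernel matrices ($r=n$), both side conditions hold for every $n\ge1$ with $\rho=\min\{R^2/\sigma^2,\sigma^2/R^2\}$. -/

import Mathlib

open MeasureTheory ProbabilityTheory Set Filter Topology
open scoped ENNReal

universe u v

namespace EarlyStopping

noncomputable section

/-- `g` (written `g lam ξ` for `g_λ(ξ)`) is an admissible spectral filter function with constants
`B`, `D`, qualification `nu` and qualification constants `Cq`. -/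
structure IsSpectralFilter (g : ℝ → ℝ → ℝ) (B D nu : ℝ) (Cq : ℝ → ℝ) : Prop where
  continuousOn : ∀ ξ ∈ Ioc (0 : ℝ) 1, ContinuousOn (fun lam => g lam ξ) (Ioi 0)
  antitoneOn : ∀ ξ ∈ Ioc (0 : ℝ) 1, AntitoneOn (fun lam => g lam ξ) (Ioi 0)
  abs_le : ∀ lam > 0, ∀ ξ ∈ Ioc (0 : ℝ) 1, |g lam ξ| ≤ B / lam
  tendsto_one : ∀ ξ ∈ Ioc (0 : ℝ) 1, Tendsto (fun lam => ξ * g lam ξ) (𝓝[>] 0) (𝓝 1)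
  abs_mul_le : ∀ lam > 0, ∀ ξ ∈ Ioc (0 : ℝ) 1, |ξ * g lam ξ| ≤ D
  qualification : ∀ s ∈ Ioc (0 : ℝ) nu, ∀ lam > 0, ∀ ξ ∈ Ioc (0 : ℝ) 1,
    |1 - ξ * g lam ξ| * ξ ^ s ≤ Cq s * lam ^ s

/-- `t ↦ lam t` is a continuous decreasing map from (continuous) iteration times `t > 0` to
regularization parameters, which tends to `0` as `t → ∞`. -/
structure IsTimeSchedule (lam : ℝ → ℝ) : Prop where
  pos : ∀ t > 0, 0 < lam t
  antitoneOn : AntitoneOn lam (Ioi 0)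
  continuousOn : ContinuousOn lam (Ioi 0)
  tendsto_zero : Tendsto lam atTop (𝓝 0)

/-- The filter at time `t`; the iterations start from the zero function at `t = 0`. -/
def filterAt (g : ℝ → ℝ → ℝ) (lam : ℝ → ℝ) (t ξ : ℝ) : ℝ := if 0 < t then g (lam t) ξ else 0

/-- The shrinkage factor `γ^{(t)} = ξ g_{λ_t}(ξ)` at the eigenvalue `ξ`. -/
def shrinkage (g : ℝ → ℝ → ℝ) (lam : ℝ → ℝ) (t ξ : ℝ) : ℝ := ξ * filterAt g lam t ξ

section Design

variable {X : Type u} (H : Type v) [NormedAddCommGroup H] [InnerProductSpace ℝ H]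
  [CompleteSpace H] [RKHS ℝ H X ℝ] {n : ℕ} (x : Fin n → X)

/-- The real-valued reproducing kernel of `H`. -/
def ker (z w : X) : ℝ := RKHS.kernel H z w 1

/-- The normalized Gram matrix `K_n`. -/
def gram : Matrix (Fin n) (Fin n) ℝ := Matrix.of fun i j => ker H (x i) (x j) / n

lemma ker_comm (z w : X) : ker H z w = ker H w z := by
  have h1 := RKHS.kernel_inner (𝕜 := ℝ) H z w (1 : ℝ) (1 : ℝ)
  have h2 := RKHS.kernel_inner (𝕜 := ℝ) H w z (1 : ℝ) (1 : ℝ)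
  rw [real_inner_comm] at h2
  simp only [RCLike.inner_apply, conj_trivial, one_mul, mul_one] at h1 h2
  rw [ker, ker, h1, h2, real_inner_comm]

lemma gram_isHermitian : (gram H x).IsHermitian := by
  ext i j
  simp [gram, ker_comm H (x i) (x j)]

/-- The eigenvalues of `K_n` (indexed compatibly with `eigvec`, not necessarily sorted). -/
def eigval (i : Fin n) : ℝ := (gram_isHermitian H x).eigenvalues i

/-- An orthonormal basis of eigenvectors of `K_n`. -/
def eigvec (i j : Fin n) : ℝ := (gram_isHermitian H x).eigenvectorBasis i j

/-- `Z_i = ⟨u_i, y⟩`. -/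
def coef (y : Fin n → ℝ) (i : Fin n) : ℝ := ∑ j, eigvec H x i j * y j

/-- Polynomial decay with exponent `β` of the nonzero empirical eigenvalues, listed in decreasing
order: `c k ^ (-β) ≤ μ_k ≤ C k ^ (-β)` for `k = i + 1 ≤ rank K_n`. -/
def PolyDecay (c C β : ℝ) : Prop :=
  ∀ i : Fin (Fintype.card (Fin n)), (i : ℕ) + 1 ≤ (gram H x).rank →
    c * (((i : ℕ) : ℝ) + 1) ^ (-β) ≤ (gram_isHermitian H x).eigenvalues₀ i ∧
      (gram_isHermitian H x).eigenvalues₀ i ≤ C * (((i : ℕ) : ℝ) + 1) ^ (-β)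

/-- The two-sided control of the shrinkage factors by `min {1, η t μ_i}`. -/
def ShrinkageBounds (g : ℝ → ℝ → ℝ) (lam : ℝ → ℝ) (a η : ℝ) : Prop :=
  ∀ t > 0, ∀ i : Fin n,
    a * min 1 (η * t * eigval H x i) ≤ shrinkage g lam t (eigval H x i) ∧
      shrinkage g lam t (eigval H x i) ≤ min 1 (η * t * eigval H x i)

/-- The spectral filter estimator `f^t = (1/n) ∑ j, (g_{λ_t}(K_n) y)_j K(·, x_j)`,
whose values at the design points form the vector `g_{λ_t}(K_n) K_n y`. -/
def spectralEstimator (g : ℝ → ℝ → ℝ) (lam : ℝ → ℝ) (t : ℝ) (y : Fin n → ℝ) : X → ℝ :=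
  fun z => (1 / (n : ℝ)) * ∑ j,
    (∑ i, filterAt g lam t (eigval H x i) * coef H x y i * eigvec H x i j) * ker H z (x j)

/-- The smoothed empirical risk `R_{α,t}` (for `α > 0`, zero eigenvalues do not contribute). -/
def smoothedRisk (g : ℝ → ℝ → ℝ) (lam : ℝ → ℝ) (α t : ℝ) (y : Fin n → ℝ) : ℝ :=
  (1 / (n : ℝ)) * ∑ i,
    eigval H x i ^ α * (1 - shrinkage g lam t (eigval H x i)) ^ 2 * coef H x y i ^ 2

/-- The smoothed minimum discrepancy stopping rule `τ_α`. -/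
def stoppingTime (g : ℝ → ℝ → ℝ) (lam : ℝ → ℝ) (σ α : ℝ) (y : Fin n → ℝ) : ℝ :=
  sInf {t : ℝ | 0 < t ∧ smoothedRisk H x g lam α t y ≤ σ ^ 2 * (∑ i, eigval H x i ^ α) / n}

/-- The early-stopped estimator `f^{τ_α}`. -/
def stoppedEstimator (g : ℝ → ℝ → ℝ) (lam : ℝ → ℝ) (σ α : ℝ) (y : Fin n → ℝ) : X → ℝ :=
  spectralEstimator H x g lam (stoppingTime H x g lam σ α y) y

/-- The squared empirical norm `‖h‖_n²`. -/
def empNormSq (h : X → ℝ) : ℝ := (1 / (n : ℝ)) * ∑ i, h (x i) ^ 2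

/-- The law of `n` i.i.d. centered Gaussian errors with variance `σ²`. -/
def noise (n : ℕ) (σ : ℝ) : Measure (Fin n → ℝ) :=
  Measure.pi fun _ => gaussianReal 0 (σ ^ 2).toNNReal

variable {H} in
/-- The fixed-design risk `E ‖est(y) - f‖_n²` under `y_i = f(x_i) + ε_i`. -/
def risk (σ : ℝ) (est : (Fin n → ℝ) → X → ℝ) (f : H) : ℝ≥0∞ :=
  ∫⁻ e, ENNReal.ofReal (empNormSq x fun z => est (fun i => f (x i) + e i) z - f z) ∂(noise n σ)

/-- The worst-case risk over the ball of radius `R` of `H`. -/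
def maxRisk (σ R : ℝ) (est : (Fin n → ℝ) → X → ℝ) : ℝ≥0∞ :=
  ⨆ f ∈ {f : H | ‖f‖ ≤ R}, risk x σ est f

/-- The minimax risk over the ball: the infimum is over all measurable functions of the data. -/
def minimaxRisk (σ R : ℝ) : ℝ≥0∞ :=
  ⨅ est ∈ {est : (Fin n → ℝ) → X → ℝ | Measurable est}, maxRisk H x σ R est

end Design

end

end EarlyStopping

/-! In the eigenbasis of the Gram matrix, after division by `σ`, the data become a Gaussian sequence
model `θ i + z i` with independent standard normal noise. The ball of radius `R` becomes the
ellipsoid `∑ θ i ^ 2 / μ i ≤ Q` with `Q = n R ^ 2 / σ ^ 2`, and the empirical risk is `σ ^ 2 / n`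
times the squared error of the sequence. Let `m` be of order `Q ^ (1 / (β + 1))`. Both the minimax
risk and the worst-case risk of the stopped filter turn out to be of order `σ ^ 2 / n * min m r`;
everything follows by comparing them.

Upper bound (`exists_loss_bound`). The natural clock is the grid of times `M ^ β / η`, at which the
filter has effective dimension `M`. The loss is split into bias and variance.

Bias (`exists_bias_bound`): after time `m ^ β / η` the qualification of the filter makes it at most
of order `m`. Before that time the stopping inequality holds at the random time. Expanding it and
using monotonicity of the shrinkage bounds the low-frequency bias by noise sums taken at the
deterministic time `m ^ β / η` (`sum_low_bias_le`). The centred noise is of order one because `2 β α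
> 1` makes `∑ μ i ^ (2 α)` bounded; this is where `α ≥ 1 / (β + 1)` enters. The condition `β α < 1`
makes removing the weights `μ i ^ α` cost no more than order `m`.

Variance (`exists_variance_bound`): not having stopped at `M ^ β / η`, for `M ≥ m`, is a large
deviation of a Gaussian quadratic form with probability exponentially small in `M`
(`exists_overshoot_bound`), so the expected variances along the grid sum to order `m`. If `m`
exceeds the rank, the stopping inequality alone yields order `r` (`exists_loss_bound_rank`).

Lower bound (`exists_le_minimaxRisk`). A cube of dimension `min m r` with sides of the order of the
noise level fits into the ball, and no estimator can determine its signs coordinatewise. -/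

namespace EarlyStopping

/-! ### Partial sums and tails of power series -/

section PowerSums

/-- Telescoping: Bernoulli's inequality for the exponent `1 - q` in `(0, 1]` bounds each term by the
increment of `m ^ (1 - q) / (1 - q)`. -/
theorem sum_range_rpow_neg_le {q : ℝ} (hq0 : 0 ≤ q) (hq1 : q < 1) (m : ℕ) :
    ∑ k ∈ Finset.range m, ((k : ℝ) + 1) ^ (-q) ≤ (m : ℝ) ^ (1 - q) / (1 - q) := by
  induction m with
  | zero => simp [Real.zero_rpow (sub_ne_zero.2 hq1.ne')]
  | succ m ih =>
    rw [Finset.sum_range_succ]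
    have h1 : 0 < 1 - q := by linarith
    have hx : (0 : ℝ) < (m : ℝ) + 1 := by positivity
    have hb := rpow_one_add_le_one_add_mul_self (s := -1 / ((m : ℝ) + 1)) (p := 1 - q)
      (by rw [le_div_iff₀ hx]; linarith [(Nat.cast_nonneg m : (0 : ℝ) ≤ m)]) h1.le (by linarith)
    have hm : (m : ℝ) = ((m : ℝ) + 1) * (1 + -1 / ((m : ℝ) + 1)) := by field_simp; ring
    have hnn : 0 ≤ 1 + -1 / ((m : ℝ) + 1) := by
      rw [show 1 + -1 / ((m : ℝ) + 1) = (m : ℝ) / (m + 1) by field_simp; ring]; positivity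
    have h2 : (m : ℝ) ^ (1 - q)
        ≤ ((m : ℝ) + 1) ^ (1 - q) * (1 + (1 - q) * (-1 / ((m : ℝ) + 1))) := by
      conv_lhs => rw [hm, Real.mul_rpow hx.le hnn]
      gcongr
    have h3 : ((m : ℝ) + 1) ^ (1 - q) = ((m : ℝ) + 1) ^ (-q) * ((m : ℝ) + 1) := by
      rw [← Real.rpow_add_one hx.ne']; congr 1; ring
    have h4 : ((m : ℝ) + 1) ^ (1 - q) * (1 + (1 - q) * (-1 / ((m : ℝ) + 1)))
        = ((m : ℝ) + 1) ^ (1 - q) - (1 - q) * ((m : ℝ) + 1) ^ (-q) := by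
      rw [h3]; field_simp; ring
    have h5 : ((m : ℝ) + 1) ^ (-q) ≤ (((m : ℝ) + 1) ^ (1 - q) - (m : ℝ) ^ (1 - q)) / (1 - q) := by
      rw [le_div_iff₀ h1]; linarith
    push_cast
    rw [sub_div] at h5
    linarith

/-- Telescoping again. The exponent `1 - q` is now negative, so the increment is controlled by
applying `x + 1 ≤ exp x` twice. The bound is uniform in the endpoint `N`. -/
theorem sum_Ico_rpow_neg_le {q : ℝ} (hq : 1 < q) {m : ℕ} (hm : 1 ≤ m) (N : ℕ) :
    ∑ k ∈ Finset.Ico m N, ((k : ℝ) + 1) ^ (-q) ≤ (m : ℝ) ^ (1 - q) / (q - 1) := by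
  have h1 : 0 < q - 1 := by linarith
  rcases le_total N m with h | h
  · rw [Finset.Ico_eq_empty (by omega), Finset.sum_empty]; positivity
  suffices H : ∑ k ∈ Finset.Ico m N, ((k : ℝ) + 1) ^ (-q)
      ≤ ((m : ℝ) ^ (1 - q) - (N : ℝ) ^ (1 - q)) / (q - 1) by
    refine H.trans ?_
    gcongr
    linarith [Real.rpow_nonneg (Nat.cast_nonneg N : (0 : ℝ) ≤ N) (1 - q)]
  induction N, h using Nat.le_induction with
  | base => simp
  | succ k hk ih =>
    rw [Finset.sum_Ico_succ_top hk]
    have hk0 : (0 : ℝ) < k := by exact_mod_cast (by omega : 0 < k)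
    have hx : (0 : ℝ) < (k : ℝ) + 1 := by positivity
    have hu : (k : ℝ) / (k + 1) ≤ Real.exp (-(1 / ((k : ℝ) + 1))) := by
      have := Real.add_one_le_exp (-(1 / ((k : ℝ) + 1)))
      rwa [show -(1 / ((k : ℝ) + 1)) + 1 = k / (k + 1) by field_simp; ring] at this
    have h2 : 1 + (q - 1) / ((k : ℝ) + 1) ≤ ((k : ℝ) / (k + 1)) ^ (1 - q) := by
      have h3 : Real.exp (-(1 / ((k : ℝ) + 1))) ^ (1 - q) ≤ ((k : ℝ) / (k + 1)) ^ (1 - q) :=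
        Real.rpow_le_rpow_of_nonpos (by positivity) hu (by linarith)
      refine le_trans ?_ h3
      rw [← Real.exp_mul]
      have := Real.add_one_le_exp (-(1 / ((k : ℝ) + 1)) * (1 - q))
      refine le_trans (le_of_eq ?_) this
      ring
    rw [Real.div_rpow hk0.le hx.le, le_div_iff₀ (by positivity)] at h2
    have h3 : ((k : ℝ) + 1) ^ (1 - q) = ((k : ℝ) + 1) ^ (-q) * ((k : ℝ) + 1) := by
      rw [← Real.rpow_add_one hx.ne']; congr 1; ring
    have h4 : (1 + (q - 1) / ((k : ℝ) + 1)) * ((k : ℝ) + 1) ^ (1 - q)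
        = ((k : ℝ) + 1) ^ (1 - q) + (q - 1) * ((k : ℝ) + 1) ^ (-q) := by
      rw [h3]; field_simp
    have h5 : ((k : ℝ) + 1) ^ (-q) ≤ ((k : ℝ) ^ (1 - q) - ((k : ℝ) + 1) ^ (1 - q)) / (q - 1) := by
      rw [le_div_iff₀ h1]; linarith
    push_cast
    rw [sub_div] at h5 ih ⊢
    linarith

end PowerSums

/-! ### Spectra with polynomial decay -/

/-- The finite family `μ`, listed through the injective enumeration `p`, has exactly `r` nonzero
members, the `k`-th of which lies between `c k ^ (-β)` and `C k ^ (-β)`. -/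
structure IsPolySpectrum {n : ℕ} (μ : Fin n → ℝ) (p : Fin n → ℕ) (r : ℕ) (c C β : ℝ) : Prop where
  inj : Function.Injective p
  surj : ∀ k < r, ∃ i, p i = k
  lower : ∀ i, p i < r → c * ((p i : ℝ) + 1) ^ (-β) ≤ μ i
  upper : ∀ i, p i < r → μ i ≤ C * ((p i : ℝ) + 1) ^ (-β)
  zero : ∀ i, r ≤ p i → μ i = 0

namespace IsPolySpectrum

variable {n : ℕ} {μ : Fin n → ℝ} {p : Fin n → ℕ} {r : ℕ} {c C β : ℝ}

theorem pos (h : IsPolySpectrum μ p r c C β) (hc : 0 < c) {i : Fin n} (hi : p i < r) : 0 < μ i :=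
  lt_of_lt_of_le (by positivity) (h.lower i hi)

theorem nonneg (h : IsPolySpectrum μ p r c C β) (hc : 0 < c) (i : Fin n) : 0 ≤ μ i := by
  rcases lt_or_ge (p i) r with hi | hi
  · exact (h.pos hc hi).le
  · exact (h.zero i hi).ge

theorem le (h : IsPolySpectrum μ p r c C β) (hC : 0 ≤ C) (i : Fin n) :
    μ i ≤ C * ((p i : ℝ) + 1) ^ (-β) := by
  rcases lt_or_ge (p i) r with hi | hi
  · exact h.upper i hi
  · rw [h.zero i hi]; positivity

theorem le_of_le (h : IsPolySpectrum μ p r c C β) (hC : 0 ≤ C) (hβ : 0 ≤ β) {M : ℕ} (hM : 1 ≤ M)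
    {i : Fin n} (hi : M ≤ p i + 1) : μ i ≤ C * (M : ℝ) ^ (-β) := by
  refine (h.le hC i).trans ?_
  have : (M : ℝ) ≤ (p i : ℝ) + 1 := by exact_mod_cast hi
  have h0 : (0 : ℝ) < M := by exact_mod_cast hM
  exact mul_le_mul_of_nonneg_left (Real.rpow_le_rpow_of_nonpos h0 this (by linarith)) hC

theorem rpow_le (h : IsPolySpectrum μ p r c C β) (hc : 0 < c) (hC : 0 ≤ C) {q : ℝ} (hq : 0 ≤ q)
    (i : Fin n) : μ i ^ q ≤ C ^ q * ((p i : ℝ) + 1) ^ (-(β * q)) := by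
  refine (Real.rpow_le_rpow (h.nonneg hc i) (h.le hC i) hq).trans (le_of_eq ?_)
  rw [Real.mul_rpow hC (by positivity), ← Real.rpow_mul (by positivity), neg_mul]

theorem sum_comp_le (h : IsPolySpectrum μ p r c C β) (s : Finset (Fin n)) (S : Finset ℕ)
    (hs : ∀ i ∈ s, p i ∈ S) {f : ℕ → ℝ} (hf : ∀ k, 0 ≤ f k) :
    ∑ i ∈ s, f (p i) ≤ ∑ k ∈ S, f k := by
  rw [← Finset.sum_image (f := f) (g := p) (fun a _ b _ hab => h.inj hab)]
  refine Finset.sum_le_sum_of_subset_of_nonneg ?_ (fun k _ _ => hf k)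
  intro k hk
  obtain ⟨i, hi, rfl⟩ := Finset.mem_image.1 hk
  exact hs i hi

theorem card_low_le (h : IsPolySpectrum μ p r c C β) (M : ℕ) :
    ((Finset.univ.filter fun i => p i < M).card : ℝ) ≤ M := by
  have := h.sum_comp_le (Finset.univ.filter fun i => p i < M) (Finset.range M) (by simp)
    (f := fun _ => 1) (by simp)
  simpa using this

theorem sum_low_rpow_le (h : IsPolySpectrum μ p r c C β) (hc : 0 < c) (hC : 0 ≤ C) (hβ : 0 ≤ β)
    {q : ℝ} (hq : 0 ≤ q) (hq1 : β * q < 1) (M : ℕ) :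
    ∑ i with p i < M, μ i ^ q ≤ C ^ q / (1 - β * q) * (M : ℝ) ^ (1 - β * q) := by
  calc ∑ i with p i < M, μ i ^ q
      ≤ ∑ i with p i < M, C ^ q * ((p i : ℝ) + 1) ^ (-(β * q)) :=
        Finset.sum_le_sum fun i _ => h.rpow_le hc hC hq i
    _ ≤ ∑ k ∈ Finset.range M, C ^ q * ((k : ℝ) + 1) ^ (-(β * q)) :=
        h.sum_comp_le _ _ (by simp) (f := fun k => C ^ q * ((k : ℝ) + 1) ^ (-(β * q)))
          (fun k => by positivity)
    _ = C ^ q * ∑ k ∈ Finset.range M, ((k : ℝ) + 1) ^ (-(β * q)) := by rw [Finset.mul_sum]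
    _ ≤ C ^ q * ((M : ℝ) ^ (1 - β * q) / (1 - β * q)) := by
        gcongr; exact sum_range_rpow_neg_le (by positivity) hq1 M
    _ = _ := by ring

theorem sum_high_rpow_le (h : IsPolySpectrum μ p r c C β) (hc : 0 < c) (hC : 0 ≤ C)
    {q : ℝ} (hq : 0 ≤ q) (hq1 : 1 < β * q) {M : ℕ} (hM : 1 ≤ M) :
    ∑ i with ¬ p i < M, μ i ^ q ≤ C ^ q / (β * q - 1) * (M : ℝ) ^ (1 - β * q) := by
  obtain ⟨N, hN⟩ : ∃ N, ∀ i, p i < N :=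
    ⟨∑ i, p i + 1, fun i => Nat.lt_succ_of_le (Finset.single_le_sum (f := p) (by simp)
      (Finset.mem_univ i))⟩
  calc ∑ i with ¬ p i < M, μ i ^ q
      ≤ ∑ i with ¬ p i < M, C ^ q * ((p i : ℝ) + 1) ^ (-(β * q)) :=
        Finset.sum_le_sum fun i _ => h.rpow_le hc hC hq i
    _ ≤ ∑ k ∈ Finset.Ico M N, C ^ q * ((k : ℝ) + 1) ^ (-(β * q)) :=
        h.sum_comp_le _ _ (by simpa using fun i hi => ⟨hi, hN i⟩)
          (f := fun k => C ^ q * ((k : ℝ) + 1) ^ (-(β * q))) (fun k => by positivity)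
    _ = C ^ q * ∑ k ∈ Finset.Ico M N, ((k : ℝ) + 1) ^ (-(β * q)) := by rw [Finset.mul_sum]
    _ ≤ C ^ q * ((M : ℝ) ^ (1 - β * q) / (β * q - 1)) := by
        gcongr; exact sum_Ico_rpow_neg_le hq1 hM N
    _ = _ := by ring

theorem sum_rpow_le_of_lt_one (h : IsPolySpectrum μ p r c C β) (hc : 0 < c) (hC : 0 ≤ C)
    (hβ : 0 ≤ β) {q : ℝ} (hq : 0 < q) (hq1 : β * q < 1) :
    ∑ i, μ i ^ q ≤ C ^ q / (1 - β * q) * (r : ℝ) ^ (1 - β * q) := by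
  refine le_trans (le_of_eq ?_) (h.sum_low_rpow_le hc hC hβ hq.le hq1 r)
  rw [Finset.sum_filter]
  refine Finset.sum_congr rfl fun i _ => ?_
  split_ifs with hi
  · rfl
  · rw [h.zero i (not_lt.1 hi), Real.zero_rpow hq.ne']

theorem sum_rpow_le_of_one_lt (h : IsPolySpectrum μ p r c C β) (hc : 0 < c) (hC : 0 ≤ C)
    (hβ : 0 ≤ β) {q : ℝ} (hq : 0 ≤ q) (hq1 : 1 < β * q) :
    ∑ i, μ i ^ q ≤ C ^ q + C ^ q / (β * q - 1) := by
  rw [← Finset.sum_filter_add_sum_filter_not _ (fun i => p i < 1)]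
  refine add_le_add ?_ (by simpa using h.sum_high_rpow_le hc hC hq hq1 le_rfl)
  calc ∑ i with p i < 1, μ i ^ q ≤ ∑ i with p i < 1, C ^ q :=
        Finset.sum_le_sum fun i _ => by
          refine Real.rpow_le_rpow (h.nonneg hc i) ?_ hq
          simpa using h.le_of_le hC hβ le_rfl (i := i) (by omega)
    _ ≤ 1 * C ^ q := by
        rw [Finset.sum_const, nsmul_eq_mul]
        gcongr
        exact_mod_cast h.card_low_le 1
    _ = C ^ q := one_mul _

/-- Splitting at index `M` and using `min ≤ 1` below and `min ≤ M ^ β * μ i` above, both pieces have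
order `M ^ (1 - β q)`. For `q = 0` this is the effective dimension at the grid time `M ^ β / η`; for
`q = α` it is its smoothed version. -/
theorem sum_rpow_mul_min_le (h : IsPolySpectrum μ p r c C β) (hc : 0 < c) (hC : 0 ≤ C)
    (hβ : 1 < β) {q : ℝ} (hq : 0 ≤ q) (hq1 : β * q < 1) {M : ℕ} (hM : 1 ≤ M) :
    ∑ i, μ i ^ q * min 1 ((M : ℝ) ^ β * μ i)
      ≤ (C ^ q / (1 - β * q) + C ^ (q + 1) / (β * (q + 1) - 1)) * (M : ℝ) ^ (1 - β * q) := by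
  have hM0 : (0 : ℝ) < M := by exact_mod_cast hM
  have hq2 : 1 < β * (q + 1) := by nlinarith
  rw [← Finset.sum_filter_add_sum_filter_not _ (fun i => p i < M), add_mul]
  refine add_le_add (le_trans ?_ (h.sum_low_rpow_le hc hC (by linarith) hq hq1 M)) ?_
  · refine Finset.sum_le_sum fun i _ => ?_
    exact mul_le_of_le_one_right (Real.rpow_nonneg (h.nonneg hc i) _) (min_le_left _ _)
  · calc ∑ i with ¬ p i < M, μ i ^ q * min 1 ((M : ℝ) ^ β * μ i)
        ≤ ∑ i with ¬ p i < M, (M : ℝ) ^ β * μ i ^ (q + 1) := by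
          refine Finset.sum_le_sum fun i _ => ?_
          have h0 := h.nonneg hc i
          rw [Real.rpow_add_one' h0 (by linarith)]
          calc μ i ^ q * min 1 ((M : ℝ) ^ β * μ i) ≤ μ i ^ q * ((M : ℝ) ^ β * μ i) := by
                gcongr; exact min_le_right _ _
            _ = _ := by ring
      _ = (M : ℝ) ^ β * ∑ i with ¬ p i < M, μ i ^ (q + 1) := by rw [Finset.mul_sum]
      _ ≤ (M : ℝ) ^ β * (C ^ (q + 1) / (β * (q + 1) - 1) * (M : ℝ) ^ (1 - β * (q + 1))) := by
          gcongr; exact h.sum_high_rpow_le hc hC (by linarith) hq2 hM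
      _ = C ^ (q + 1) / (β * (q + 1) - 1) * ((M : ℝ) ^ β * (M : ℝ) ^ (1 - β * (q + 1))) := by ring
      _ = _ := by rw [← Real.rpow_add hM0]; congr 2; ring

theorem le_min_one_mul (h : IsPolySpectrum μ p r c C β) (hβ : 0 ≤ β) {i : Fin n}
    {M : ℝ} (hc : 0 < c) (hi : p i < r) (hM : (p i : ℝ) + 1 ≤ M) : min 1 c ≤ min 1 (M ^ β * μ i) := by
  refine min_le_min le_rfl ?_
  have hp : (0 : ℝ) < (p i : ℝ) + 1 := by positivity
  calc c = ((p i : ℝ) + 1) ^ β * (c * ((p i : ℝ) + 1) ^ (-β)) := by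
        rw [Real.rpow_neg hp.le]; field_simp
    _ ≤ M ^ β * μ i := mul_le_mul (Real.rpow_le_rpow hp.le hM hβ) (h.lower i hi) (by positivity)
        (Real.rpow_nonneg (by linarith) _)

theorem low_rpow_ge (h : IsPolySpectrum μ p r c C β) (hc : 0 < c) (hβ : 0 ≤ β) {q : ℝ}
    (hq : 0 ≤ q) {M : ℕ} {i : Fin n} (hi : p i < M) (hM : p i < r) :
    c ^ q * (M : ℝ) ^ (-(β * q)) ≤ μ i ^ q := by
  have hp : (0 : ℝ) < (p i : ℝ) + 1 := by positivity
  have hle : (p i : ℝ) + 1 ≤ M := by exact_mod_cast hi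
  calc c ^ q * (M : ℝ) ^ (-(β * q)) ≤ c ^ q * ((p i : ℝ) + 1) ^ (-(β * q)) := by
        gcongr c ^ q * ?_
        exact Real.rpow_le_rpow_of_nonpos hp hle (by have := mul_nonneg hβ hq; linarith)
    _ = (c * ((p i : ℝ) + 1) ^ (-β)) ^ q := by
        rw [Real.mul_rpow hc.le (by positivity), ← Real.rpow_mul hp.le, neg_mul]
    _ ≤ μ i ^ q := Real.rpow_le_rpow (by positivity) (h.lower i hM) hq

theorem card_low_ge (h : IsPolySpectrum μ p r c C β) {M : ℕ} (hM : M ≤ r) :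
    (M : ℝ) ≤ ((Finset.univ.filter fun i => p i < M).card : ℝ) := by
  have : Finset.range M ⊆ (Finset.univ.filter fun i => p i < M).image p := by
    intro k hk
    obtain ⟨i, rfl⟩ := h.surj k (lt_of_lt_of_le (Finset.mem_range.1 hk) hM)
    exact Finset.mem_image_of_mem _ (by simpa using hk)
  have := (Finset.card_le_card this).trans Finset.card_image_le
  simpa using this

/-- Matching lower bound: the first `M` indices already suffice, hence the need for `M ≤ r`. -/
theorem le_sum_rpow_mul_min (h : IsPolySpectrum μ p r c C β) (hc : 0 < c)
    (hβ : 0 ≤ β) {q : ℝ} (hq : 0 ≤ q) {M : ℕ} (hM : 1 ≤ M) (hMr : M ≤ r) :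
    c ^ q * min 1 c * (M : ℝ) ^ (1 - β * q) ≤ ∑ i, μ i ^ q * min 1 ((M : ℝ) ^ β * μ i) := by
  have hM0 : (0 : ℝ) < M := by exact_mod_cast hM
  have hmin : 0 < min 1 c := lt_min one_pos hc
  calc c ^ q * min 1 c * (M : ℝ) ^ (1 - β * q)
      = M * (c ^ q * (M : ℝ) ^ (-(β * q)) * min 1 c) := by
        rw [sub_eq_add_neg, Real.rpow_add hM0, Real.rpow_one]; ring
    _ ≤ ∑ i with p i < M, (c ^ q * (M : ℝ) ^ (-(β * q)) * min 1 c) := by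
        rw [Finset.sum_const, nsmul_eq_mul]
        gcongr
        exact_mod_cast h.card_low_ge hMr
    _ ≤ ∑ i with p i < M, μ i ^ q * min 1 ((M : ℝ) ^ β * μ i) := by
        refine Finset.sum_le_sum fun i hi => ?_
        have hi : p i < M := by simpa using hi
        exact mul_le_mul (h.low_rpow_ge hc hβ hq hi (hi.trans_le hMr))
          (h.le_min_one_mul hβ hc (hi.trans_le hMr) (by exact_mod_cast hi)) hmin.le
          (Real.rpow_nonneg (h.nonneg hc i) _)
    _ ≤ _ := Finset.sum_le_sum_of_subset_of_nonneg (Finset.filter_subset _ _) fun i _ _ => by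
        have := h.nonneg hc i
        positivity

end IsPolySpectrum

/-! ### Exponential moments of Gaussian quadratic polynomials -/

section GaussianQuadratic

/-- After squaring, the claim is `1 ≤ (1 - 2 A) * exp (2 A + 4 A ^ 2)`. The quadratic lower bound of
`exp` is needed for `A ≥ 0`; for `A ≤ 0` the linear one is enough. -/
theorem inv_sqrt_one_sub_le {A : ℝ} (hA : |A| ≤ 1 / 4) :
    (√(1 - 2 * A))⁻¹ ≤ Real.exp (A + 2 * A ^ 2) := by
  obtain ⟨h1, h2⟩ := abs_le.1 hA
  have hpos : 0 < 1 - 2 * A := by linarith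
  have key : 1 ≤ (1 - 2 * A) * Real.exp (2 * (A + 2 * A ^ 2)) := by
    rcases le_total 0 A with hA0 | hA0
    · have h := Real.quadratic_le_exp_of_nonneg (x := 2 * (A + 2 * A ^ 2)) (by positivity)
      refine le_trans ?_ (mul_le_mul_of_nonneg_left h hpos.le)
      have : 0 ≤ A ^ 2 * (2 - 4 * A - 8 * A ^ 2 - 16 * A ^ 3) := by
        refine mul_nonneg (sq_nonneg _) ?_
        nlinarith [mul_nonneg hA0 hA0, mul_nonneg hA0 (mul_nonneg hA0 hA0)]
      nlinarith [this]
    · have h := Real.add_one_le_exp (2 * (A + 2 * A ^ 2))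
      refine le_trans ?_ (mul_le_mul_of_nonneg_left h hpos.le)
      nlinarith [mul_nonneg (neg_nonneg.2 hA0) (sq_nonneg A)]
  have hs : 0 < √(1 - 2 * A) := Real.sqrt_pos.2 hpos
  rw [inv_le_iff_one_le_mul₀ hs]
  have h2 : 1 ≤ (Real.exp (A + 2 * A ^ 2) * √(1 - 2 * A)) ^ 2 := by
    rw [mul_pow, Real.sq_sqrt hpos.le, ← Real.exp_nat_mul]
    push_cast
    linarith
  exact (one_le_sq_iff₀ (by positivity)).1 h2

/-- Completing the square turns the integrand into a multiple of another Gaussian density, with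
factor `(1 - 2 A) ^ (-1 / 2) * exp (B ^ 2 / (2 (1 - 2 A)))`; here `2 (1 - 2 A) ≥ 1`. -/
theorem gaussian_exp_quadratic {A : ℝ} (hA : |A| ≤ 1 / 4) (B : ℝ) :
    Integrable (fun x => Real.exp (A * x ^ 2 + B * x)) (gaussianReal 0 1) ∧
      ∫ x, Real.exp (A * x ^ 2 + B * x) ∂(gaussianReal 0 1) ≤ Real.exp (A + 2 * A ^ 2 + B ^ 2) := by
  obtain ⟨h1, h2⟩ := abs_le.1 hA
  have hpos : 0 < 1 - 2 * A := by linarith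
  have hv : ((1 - 2 * A)⁻¹.toNNReal : ℝ) = (1 - 2 * A)⁻¹ := Real.coe_toNNReal _ (by positivity)
  have hv0 : (1 - 2 * A)⁻¹.toNNReal ≠ 0 := by
    rw [Ne, Real.toNNReal_eq_zero, not_le]; positivity
  have hpt : ∀ x : ℝ, gaussianPDFReal 0 1 x * Real.exp (A * x ^ 2 + B * x)
      = ((√(1 - 2 * A))⁻¹ * Real.exp (B ^ 2 / (2 * (1 - 2 * A)))) *
        gaussianPDFReal (B / (1 - 2 * A)) (1 - 2 * A)⁻¹.toNNReal x := by
    intro x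
    rw [gaussianPDFReal, gaussianPDFReal, hv]
    have hs : √(2 * Real.pi * (1 - 2 * A)⁻¹) = √(2 * Real.pi) * (√(1 - 2 * A))⁻¹ := by
      rw [Real.sqrt_mul (by positivity), Real.sqrt_inv]
    rw [hs, NNReal.coe_one, mul_one, mul_one, mul_inv, inv_inv]
    have hs0 : √(1 - 2 * A) ≠ 0 := (Real.sqrt_pos.2 hpos).ne'
    rw [show (√(1 - 2 * A))⁻¹ * Real.exp (B ^ 2 / (2 * (1 - 2 * A))) *
      ((√(2 * Real.pi))⁻¹ * √(1 - 2 * A) *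
        Real.exp (-(x - B / (1 - 2 * A)) ^ 2 / (2 * (1 - 2 * A)⁻¹)))
      = (√(2 * Real.pi))⁻¹ * (Real.exp (B ^ 2 / (2 * (1 - 2 * A))) *
        Real.exp (-(x - B / (1 - 2 * A)) ^ 2 / (2 * (1 - 2 * A)⁻¹))) by field_simp,
      mul_assoc, ← Real.exp_add, ← Real.exp_add]
    congr 2
    have := hpos.ne'
    field_simp
    ring
  constructor
  · rw [gaussianReal_of_var_ne_zero _ one_ne_zero, gaussianPDF_def,
      integrable_withDensity_iff_integrable_smul₀' (by fun_prop) (by simp)]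
    simp only [ENNReal.toReal_ofReal (gaussianPDFReal_nonneg _ _ _), smul_eq_mul, hpt]
    exact (integrable_gaussianPDFReal _ _).const_mul _
  · rw [integral_gaussianReal_eq_integral_smul one_ne_zero]
    simp only [smul_eq_mul, hpt]
    rw [integral_const_mul, integral_gaussianPDFReal_eq_one _ hv0, mul_one, Real.exp_add]
    refine mul_le_mul (inv_sqrt_one_sub_le hA) (Real.exp_le_exp.2 ?_) (Real.exp_nonneg _)
      (Real.exp_nonneg _)
    rw [div_le_iff₀ (by positivity)]
    nlinarith [sq_nonneg B]

theorem gaussian_integrable_sq : Integrable (fun x : ℝ => x ^ 2) (gaussianReal 0 1) :=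
  (memLp_id_gaussianReal (μ := 0) (v := 1) 2).integrable_sq

theorem gaussian_integral_sq : ∫ x, x ^ 2 ∂(gaussianReal 0 1) = 1 := by
  have := variance_id_gaussianReal (μ := 0) (v := 1)
  rw [variance_eq_integral (by fun_prop)] at this
  simpa using this

end GaussianQuadratic

/-! ### Integrable majorants under Gaussian noise -/

/-- The standard Gaussian measure on `ℝⁿ`. -/
noncomputable abbrev stdNoise (n : ℕ) : Measure (Fin n → ℝ) := Measure.pi fun _ => gaussianReal 0 1

/-- `F` is integrable under standard Gaussian noise, with mean at most `b`. -/
def HasMeanLE {n : ℕ} (F : (Fin n → ℝ) → ℝ) (b : ℝ) : Prop :=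
  Integrable F (stdNoise n) ∧ ∫ z, F z ∂(stdNoise n) ≤ b

namespace HasMeanLE

variable {n : ℕ} {F G : (Fin n → ℝ) → ℝ} {b d : ℝ}

theorem mono (h : HasMeanLE F b) (hbd : b ≤ d) : HasMeanLE F d := ⟨h.1, h.2.trans hbd⟩

theorem const (b : ℝ) : HasMeanLE (fun _ : Fin n → ℝ => b) b := ⟨integrable_const _, by simp⟩

theorem add (h : HasMeanLE F b) (h' : HasMeanLE G d) : HasMeanLE (fun z => F z + G z) (b + d) :=
  ⟨h.1.add h'.1, by rw [integral_add h.1 h'.1]; exact add_le_add h.2 h'.2⟩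

theorem const_mul (h : HasMeanLE F b) {k : ℝ} (hk : 0 ≤ k) : HasMeanLE (fun z => k * F z) (k * b) :=
  ⟨h.1.const_mul k, by rw [integral_const_mul]; exact mul_le_mul_of_nonneg_left h.2 hk⟩

theorem sum {ι : Type*} {s : Finset ι} {F : ι → (Fin n → ℝ) → ℝ} {b : ι → ℝ}
    (h : ∀ i ∈ s, HasMeanLE (F i) (b i)) : HasMeanLE (fun z => ∑ i ∈ s, F i z) (∑ i ∈ s, b i) :=
  ⟨integrable_finsetSum _ fun i hi => (h i hi).1, by
    rw [integral_finsetSum _ fun i hi => (h i hi).1]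
    exact Finset.sum_le_sum fun i hi => (h i hi).2⟩

theorem sq_coord (i : Fin n) : HasMeanLE (fun z : Fin n → ℝ => z i ^ 2) 1 := by
  have hmp := measurePreserving_eval (fun _ : Fin n => gaussianReal 0 1) i
  refine ⟨hmp.integrable_comp_of_integrable gaussian_integrable_sq, ?_⟩
  have := hmp.hasLaw.integral_comp (f := fun x => x ^ 2) (by fun_prop)
  simp only [Function.comp_def, Function.eval] at this
  rw [this, gaussian_integral_sq]

theorem sum_mul_sq (s : Finset (Fin n)) {w : Fin n → ℝ} (hw : ∀ i, 0 ≤ w i) (hb : ∑ i ∈ s, w i ≤ b) :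
    HasMeanLE (fun z => ∑ i ∈ s, w i * z i ^ 2) b :=
  (HasMeanLE.sum fun i _ => (sq_coord i).const_mul (hw i)).mono (by simpa using hb)

theorem exp_quadratic {A B : Fin n → ℝ} {k : ℝ} (hA : ∀ i, |A i| ≤ 1 / 4)
    (hb : ∑ i, (A i + 2 * A i ^ 2 + B i ^ 2) + k ≤ b) :
    HasMeanLE (fun z => Real.exp (∑ i, (A i * z i ^ 2 + B i * z i) + k)) (Real.exp b) := by
  have he : ∀ z : Fin n → ℝ, Real.exp (∑ i, (A i * z i ^ 2 + B i * z i) + k)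
      = Real.exp k * ∏ i, Real.exp (A i * z i ^ 2 + B i * z i) := fun z => by
    rw [Real.exp_add, Real.exp_sum, mul_comm]
  simp only [he]
  refine HasMeanLE.mono (b := Real.exp k * ∏ i, Real.exp (A i + 2 * A i ^ 2 + B i ^ 2))
    (HasMeanLE.const_mul ⟨Integrable.fintype_prod fun i => (gaussian_exp_quadratic (hA i) (B i)).1, ?_⟩
    (Real.exp_nonneg _)) ?_
  · rw [integral_fintype_prod_eq_prod (fun i (x : ℝ) => Real.exp (A i * x ^ 2 + B i * x))]
    exact Finset.prod_le_prod (fun i _ => integral_nonneg fun x => Real.exp_nonneg _)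
      fun i _ => (gaussian_exp_quadratic (hA i) (B i)).2
  · rw [← Real.exp_sum, ← Real.exp_add]
    exact Real.exp_le_exp.2 (by linarith)

/-- Only the majorant `F` has to be integrable: no measurability of `f` is required, so losses
evaluated at a random time can be bounded pointwise. -/
theorem lintegral_le (h : HasMeanLE F b) (hF : ∀ z, 0 ≤ F z) {f : (Fin n → ℝ) → ℝ}
    (hf : ∀ z, f z ≤ F z) : ∫⁻ z, ENNReal.ofReal (f z) ∂(stdNoise n) ≤ ENNReal.ofReal b :=
  calc ∫⁻ z, ENNReal.ofReal (f z) ∂(stdNoise n) ≤ ∫⁻ z, ENNReal.ofReal (F z) ∂(stdNoise n) :=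
        lintegral_mono fun z => ENNReal.ofReal_le_ofReal (hf z)
    _ = ENNReal.ofReal (∫ z, F z ∂(stdNoise n)) :=
        (ofReal_integral_eq_lintegral_ofReal h.1 (ae_of_all _ hF)).symm
    _ ≤ ENNReal.ofReal b := ENNReal.ofReal_le_ofReal h.2

/-- First absolute moment from exponential moments, through `|S| ≤ exp S + exp (-S)` with `S` the
sum scaled by `δ`. Centring cancels the linear term of the exponent, leaving only `2 (δ w i) ^ 2`.
-/
theorem abs_sum_sq_sub_one {w : Fin n → ℝ} {δ K : ℝ} (hδ : 0 < δ) (hw : ∀ i, |δ * w i| ≤ 1 / 4)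
    (hK : ∑ i, 2 * (δ * w i) ^ 2 ≤ K) :
    HasMeanLE (fun z : Fin n → ℝ => δ⁻¹ * (Real.exp (∑ i, δ * w i * (z i ^ 2 - 1))
      + Real.exp (∑ i, -(δ * w i) * (z i ^ 2 - 1)))) (δ⁻¹ * (Real.exp K + Real.exp K)) ∧
    ∀ z : Fin n → ℝ, |∑ i, w i * (z i ^ 2 - 1)| ≤ δ⁻¹ * (Real.exp (∑ i, δ * w i * (z i ^ 2 - 1))
      + Real.exp (∑ i, -(δ * w i) * (z i ^ 2 - 1))) := by
  refine ⟨((?_ : HasMeanLE _ _).add (?_ : HasMeanLE _ _)).const_mul (by positivity), fun z => ?_⟩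
  · have := exp_quadratic (A := fun i => δ * w i) (B := 0) (k := -∑ i, δ * w i) (b := K) hw (by
      simp only [Finset.sum_add_distrib]; simpa using hK)
    convert this using 4 with z
    simp [mul_add, Finset.sum_add_distrib, sub_eq_add_neg]
  · have := exp_quadratic (A := fun i => -(δ * w i)) (B := 0) (k := ∑ i, δ * w i) (b := K)
      (by simpa using hw) (by simp only [Finset.sum_add_distrib]; simpa using hK)
    convert this using 4 with z
    simp [Finset.sum_add_distrib, sub_eq_add_neg, mul_add]
  · set S := ∑ i, δ * w i * (z i ^ 2 - 1) with hS
    have h1 : ∑ i, w i * (z i ^ 2 - 1) = δ⁻¹ * S := by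
      rw [hS, Finset.mul_sum]
      exact Finset.sum_congr rfl fun i _ => by field_simp
    have h2 : ∑ i, -(δ * w i) * (z i ^ 2 - 1) = -S := by simp [hS]
    rw [h1, h2, abs_mul, abs_of_pos (inv_pos.2 hδ)]
    gcongr
    have := Real.add_one_le_exp S
    have := Real.add_one_le_exp (-S)
    have := Real.exp_pos S
    have := Real.exp_pos (-S)
    exact abs_le.2 ⟨by linarith, by linarith⟩

theorem abs_sum_linear {w : Fin n → ℝ} {K : ℝ} (hK : ∑ i, w i ^ 2 ≤ K) :
    HasMeanLE (fun z : Fin n → ℝ => Real.exp (∑ i, w i * z i)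
      + Real.exp (∑ i, -w i * z i)) (Real.exp K + Real.exp K) ∧
    ∀ z : Fin n → ℝ, |∑ i, w i * z i| ≤ Real.exp (∑ i, w i * z i) + Real.exp (∑ i, -w i * z i) := by
  refine ⟨(?_ : HasMeanLE _ _).add (?_ : HasMeanLE _ _), fun z => ?_⟩
  · simpa using exp_quadratic (A := 0) (B := w) (k := 0) (b := K) (by simp) (by simpa using hK)
  · simpa using exp_quadratic (A := 0) (B := fun i => -w i) (k := 0) (b := K) (by simp)
      (by simpa using hK)
  · set S := ∑ i, w i * z i with hS
    have h2 : ∑ i, -w i * z i = -S := by simp [hS]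
    rw [h2]
    have := Real.add_one_le_exp S
    have := Real.add_one_le_exp (-S)
    have := Real.exp_pos S
    have := Real.exp_pos (-S)
    exact abs_le.2 ⟨by linarith, by linarith⟩

end HasMeanLE

/-! ### The sequence model: shrinkage, ellipsoids, stopping -/

/-- Shrinkage factors `γ t i`, monotone in time, comparable to `min {1, η t μ_i}`, whose residual at
time `M ^ β / η` is of order `M ^ (-β) / μ_i`. -/
structure IsShrinkageFamily {n : ℕ} (γ : ℝ → Fin n → ℝ) (μ : Fin n → ℝ) (r : ℕ) (a η L β : ℝ) :
    Prop where
  eta_pos : 0 < η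
  mono : ∀ i, Monotone fun t => γ t i
  nonneg : ∀ t i, 0 ≤ γ t i
  le_one : ∀ t i, γ t i ≤ 1
  lower : ∀ t > 0, ∀ i, a * min 1 (η * t * μ i) ≤ γ t i
  upper : ∀ t > 0, ∀ i, γ t i ≤ min 1 (η * t * μ i)
  resid : ∀ M : ℕ, 1 ≤ M → M ≤ r → ∀ i, (1 - γ ((M : ℝ) ^ β / η) i) * μ i ≤ L * (M : ℝ) ^ (-β)

/-- `θ` belongs to the ellipsoid with semi-axes `√(Q μ_i)`. -/
structure MemEllipsoid {n : ℕ} (θ μ : Fin n → ℝ) (Q : ℝ) : Prop where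
  zero : ∀ i, μ i = 0 → θ i = 0
  sum_le : ∑ i, θ i ^ 2 / μ i ≤ Q

/-- `τ` is the first time at which the smoothed empirical risk of the data is at most its level. -/
structure IsStoppingRule {n : ℕ} (γ : ℝ → Fin n → ℝ) (μ : Fin n → ℝ) (α : ℝ)
    (τ : (Fin n → ℝ) → ℝ) : Prop where
  risk_le : ∀ y, ∑ i, μ i ^ α * (1 - γ (τ y) i) ^ 2 * y i ^ 2 ≤ ∑ i, μ i ^ α
  lt_risk : ∀ y, ∀ t > 0, t < τ y → ∑ i, μ i ^ α < ∑ i, μ i ^ α * (1 - γ t i) ^ 2 * y i ^ 2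

namespace IsShrinkageFamily

variable {n : ℕ} {γ : ℝ → Fin n → ℝ} {μ : Fin n → ℝ} {r : ℕ} {a η L β : ℝ}

theorem time_pos (h : IsShrinkageFamily γ μ r a η L β) {M : ℕ} (hM : 1 ≤ M) :
    0 < (M : ℝ) ^ β / η :=
  div_pos (Real.rpow_pos_of_pos (by exact_mod_cast hM) _) h.eta_pos

theorem upper_time (h : IsShrinkageFamily γ μ r a η L β) {M : ℕ} (hM : 1 ≤ M) (i : Fin n) :
    γ ((M : ℝ) ^ β / η) i ≤ min 1 ((M : ℝ) ^ β * μ i) := by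
  have := h.upper _ (h.time_pos hM) i
  rwa [mul_div_cancel₀ _ h.eta_pos.ne'] at this

theorem lower_time (h : IsShrinkageFamily γ μ r a η L β) {M : ℕ} (hM : 1 ≤ M) (i : Fin n) :
    a * min 1 ((M : ℝ) ^ β * μ i) ≤ γ ((M : ℝ) ^ β / η) i := by
  have := h.lower _ (h.time_pos hM) i
  rwa [mul_div_cancel₀ _ h.eta_pos.ne'] at this

/-- Interpolation between the bound on the residual and the trivial bound by one: a factor `w` in
`[0, 1]` satisfies `w ^ 2 ≤ w ^ q` for `q ≤ 2`. -/
theorem resid_rpow_le (h : IsShrinkageFamily γ μ r a η L β) (hμ : ∀ i, 0 ≤ μ i) (hL : 0 ≤ L)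
    {q : ℝ} (hq : 0 ≤ q) (hq2 : q ≤ 2) {M : ℕ} (hM : 1 ≤ M) (hMr : M ≤ r) (i : Fin n) :
    μ i ^ q * (1 - γ ((M : ℝ) ^ β / η) i) ^ 2 ≤ L ^ q * (M : ℝ) ^ (-(β * q)) := by
  set w := 1 - γ ((M : ℝ) ^ β / η) i with hw
  have hw0 : 0 ≤ w := sub_nonneg.2 (h.le_one _ _)
  have hw1 : w ≤ 1 := sub_le_self _ (h.nonneg _ _)
  have h1 : w ^ 2 ≤ w ^ q := by
    rcases hq.eq_or_lt with rfl | hq'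
    · rw [Real.rpow_zero]; exact pow_le_one₀ hw0 hw1
    · rw [← Real.rpow_two]
      exact Real.rpow_le_rpow_of_exponent_ge' hw0 hw1 hq hq2
  calc μ i ^ q * w ^ 2 ≤ μ i ^ q * w ^ q :=
        mul_le_mul_of_nonneg_left h1 (Real.rpow_nonneg (hμ i) _)
    _ = (w * μ i) ^ q := by rw [Real.mul_rpow hw0 (hμ i), mul_comm]
    _ ≤ (L * (M : ℝ) ^ (-β)) ^ q :=
        Real.rpow_le_rpow (mul_nonneg hw0 (hμ i)) (h.resid M hM hMr i) hq
    _ = L ^ q * (M : ℝ) ^ (-(β * q)) := by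
        rw [Real.mul_rpow hL (by positivity), ← Real.rpow_mul (by positivity), neg_mul]

end IsShrinkageFamily

namespace MemEllipsoid

variable {n : ℕ} {θ μ : Fin n → ℝ} {Q : ℝ}

theorem sum_mul_sq_le (h : MemEllipsoid θ μ Q) (hμ : ∀ i, 0 ≤ μ i) (s : Finset (Fin n))
    {w : Fin n → ℝ} {b : ℝ} (hb : 0 ≤ b) (hw : ∀ i ∈ s, 0 < μ i → w i * μ i ≤ b) :
    ∑ i ∈ s, w i * θ i ^ 2 ≤ b * Q := by
  calc ∑ i ∈ s, w i * θ i ^ 2 ≤ ∑ i ∈ s, b * (θ i ^ 2 / μ i) := by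
        refine Finset.sum_le_sum fun i hi => ?_
        rcases (hμ i).eq_or_lt with h0 | h0
        · simp [h.zero i h0.symm]
        · have := mul_le_mul_of_nonneg_right (hw i hi h0) (div_nonneg (sq_nonneg (θ i)) h0.le)
          refine le_trans (le_of_eq ?_) this
          field_simp
    _ ≤ ∑ i, b * (θ i ^ 2 / μ i) :=
        Finset.sum_le_sum_of_subset_of_nonneg (Finset.subset_univ s) fun i _ _ =>
          mul_nonneg hb (div_nonneg (sq_nonneg _) (hμ i))
    _ = b * ∑ i, θ i ^ 2 / μ i := by rw [Finset.mul_sum]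
    _ ≤ b * Q := mul_le_mul_of_nonneg_left h.sum_le hb

theorem radius_nonneg (h : MemEllipsoid θ μ Q) (hμ : ∀ i, 0 ≤ μ i) : 0 ≤ Q :=
  (Finset.sum_nonneg fun i _ => div_nonneg (sq_nonneg _) (hμ i)).trans h.sum_le

end MemEllipsoid

/-! ### Upper bound in the sequence model -/

/-- Bounds a low-frequency bias by noise terms that do not involve the random time. -/
theorem sum_low_bias_le {n : ℕ} (J : Fin n → Prop) [DecidablePred J] {U γ Γ θ z : Fin n → ℝ}
    (hU : ∀ i, 0 ≤ U i) (hγ : ∀ i, 0 ≤ γ i) (hγΓ : ∀ i, γ i ≤ Γ i) (hΓ : ∀ i, Γ i ≤ 1)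
    (h : ∑ i, U i * (1 - γ i) ^ 2 * (θ i + z i) ^ 2 ≤ ∑ i, U i) :
    ∑ i with J i, U i * (1 - γ i) ^ 2 * θ i ^ 2 ≤
      2 * |∑ i, U i * (z i ^ 2 - 1)| + 8 * ∑ i, U i * Γ i * z i ^ 2
        + 4 * ∑ i with J i, U i * z i ^ 2
        + 4 * |∑ i, (if J i then 0 else U i * θ i) * z i| + 2 * ∑ i with ¬ J i, U i * θ i ^ 2 := by
  -- The random factor `w = (1 - γ i) ^ 2` must disappear from all noise terms. It does so through
  -- `0 ≤ w ≤ 1` and `1 - w ≤ 2 Γ i`. Inside `J`, half of the bias is kept via `(θ + z) ^ 2 ≥ θ ^ 2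
  -- / 2 - z ^ 2`; outside `J`, the cross term is kept exactly with a coefficient free of the random
  -- time.
  have key : ∀ i, (if J i then U i * (1 - γ i) ^ 2 * θ i ^ 2 else 0) / 2 + U i * (z i ^ 2 - 1)
      - 4 * (U i * Γ i * z i ^ 2) - 2 * (if J i then U i * z i ^ 2 else 0)
      + 2 * ((if J i then 0 else U i * θ i) * z i) - (if ¬ J i then U i * θ i ^ 2 else 0)
      ≤ U i * (1 - γ i) ^ 2 * (θ i + z i) ^ 2 - U i := by
    intro i
    have hg0 := hγ i
    have hg1 : γ i ≤ 1 := (hγΓ i).trans (hΓ i)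
    have hw : 0 ≤ (1 - γ i) ^ 2 := sq_nonneg _
    have hw1 : (1 - γ i) ^ 2 ≤ 1 := pow_le_one₀ (by linarith) (by linarith)
    have hv : 1 - (1 - γ i) ^ 2 ≤ 2 * Γ i := by nlinarith [hγΓ i]
    set w := (1 - γ i) ^ 2
    have hz := mul_le_mul_of_nonneg_right hv (sq_nonneg (z i))
    by_cases hJ : J i
    · simp only [hJ, if_true, not_true_eq_false, if_false]
      have : w * θ i ^ 2 / 2 + (z i ^ 2 - 1) - 4 * (Γ i * z i ^ 2) - 2 * z i ^ 2
          ≤ w * (θ i + z i) ^ 2 - 1 := by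
        nlinarith [mul_nonneg hw (sq_nonneg (θ i + 2 * z i)), sq_nonneg (z i),
          mul_nonneg (sub_nonneg.2 hw1) (sq_nonneg (z i))]
      nlinarith [mul_le_mul_of_nonneg_left this (hU i)]
    · simp only [hJ, if_true, not_false_eq_true, if_false]
      have : (z i ^ 2 - 1) - 4 * (Γ i * z i ^ 2) + 2 * (θ i * z i) - θ i ^ 2
          ≤ w * (θ i + z i) ^ 2 - 1 := by
        nlinarith [mul_nonneg hw (sq_nonneg (θ i)), sq_nonneg (z i),
          mul_nonneg (sub_nonneg.2 hw1) (sq_nonneg (z i - θ i)), mul_nonneg hw (sq_nonneg (θ i)),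
          mul_nonneg (sub_nonneg.2 hw1) (sq_nonneg (z i))]
      nlinarith [mul_le_mul_of_nonneg_left this (hU i)]
  have hs := Finset.sum_le_sum fun i (_ : i ∈ Finset.univ) => key i
  simp only [Finset.sum_add_distrib, Finset.sum_sub_distrib, ← Finset.mul_sum,
    ← Finset.sum_div, ← Finset.sum_filter] at hs
  have h1 := neg_abs_le (∑ i, U i * (z i ^ 2 - 1))
  have h2 := neg_abs_le (∑ i, (if J i then 0 else U i * θ i) * z i)
  linarith

section Upper

variable {α β c C a L : ℝ}

/-- The second-order term of the Chernoff exponent. Below index `M` each summand is at most `(L ^ α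
* M ^ (-βα)) ^ 2`; above it the tail of `∑ μ i ^ (2 α)` has the same order since `2 β α > 1`. -/
theorem sum_sq_resid_le (hβ : 1 < β) (hα0 : 0 < α) (hα2 : 1 < 2 * (β * α)) (hα1 : β * α < 1)
    (hc : 0 < c) (hC : 0 < C) (hL : 0 < L) :
    ∃ K > 0, ∀ {n : ℕ} {μ : Fin n → ℝ} {p : Fin n → ℕ} {r : ℕ} {γ : ℝ → Fin n → ℝ} {η : ℝ},
      IsPolySpectrum μ p r c C β → IsShrinkageFamily γ μ r a η L β →
      ∀ {M : ℕ}, 1 ≤ M → M ≤ r →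
        ∑ i, (μ i ^ α * (1 - γ ((M : ℝ) ^ β / η) i) ^ 2) ^ 2 ≤ K * (M : ℝ) ^ (1 - 2 * (β * α)) := by
  have hd : 0 < β * (2 * α) - 1 := by linarith
  refine ⟨(L ^ α) ^ 2 + C ^ (2 * α) / (β * (2 * α) - 1), by positivity, ?_⟩
  intro n μ p r γ η hμ hγ M hM hMr
  have hM0 : (0 : ℝ) < M := by exact_mod_cast hM
  have hα : α ≤ 2 := by nlinarith
  have hn := hμ.nonneg hc
  rw [← Finset.sum_filter_add_sum_filter_not _ (fun i => p i < M), add_mul]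
  refine add_le_add ?_ ?_
  · calc ∑ i with p i < M, (μ i ^ α * (1 - γ ((M : ℝ) ^ β / η) i) ^ 2) ^ 2
        ≤ ∑ i with p i < M, (L ^ α * (M : ℝ) ^ (-(β * α))) ^ 2 :=
          Finset.sum_le_sum fun i _ => pow_le_pow_left₀
            (mul_nonneg (Real.rpow_nonneg (hn i) _) (sq_nonneg _))
            (hγ.resid_rpow_le hn hL.le hα0.le hα hM hMr i) 2
      _ ≤ M * (L ^ α * (M : ℝ) ^ (-(β * α))) ^ 2 := by
          rw [Finset.sum_const, nsmul_eq_mul]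
          exact mul_le_mul_of_nonneg_right (hμ.card_low_le M) (sq_nonneg _)
      _ = _ := by
          rw [mul_pow, ← Real.rpow_natCast ((M : ℝ) ^ (-(β * α))) 2, ← Real.rpow_mul hM0.le,
            sub_eq_add_neg, Real.rpow_add hM0, Real.rpow_one]
          push_cast
          rw [show -(β * α) * 2 = -(2 * (β * α)) by ring]
          ring
  · calc ∑ i with ¬ p i < M, (μ i ^ α * (1 - γ ((M : ℝ) ^ β / η) i) ^ 2) ^ 2
        ≤ ∑ i with ¬ p i < M, μ i ^ (2 * α) := by
          refine Finset.sum_le_sum fun i _ => ?_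
          have h1 : (1 - γ ((M : ℝ) ^ β / η) i) ^ 2 ≤ 1 :=
            pow_le_one₀ (sub_nonneg.2 (hγ.le_one _ _)) (sub_le_self _ (hγ.nonneg _ _))
          rw [mul_comm 2 α, Real.rpow_mul (hn i), Real.rpow_two]
          exact pow_le_pow_left₀ (mul_nonneg (Real.rpow_nonneg (hn i) _) (sq_nonneg _))
            (mul_le_of_le_one_right (Real.rpow_nonneg (hn i) _) h1) 2
      _ ≤ _ := hμ.sum_high_rpow_le hc hC.le (by linarith) (by linarith) hM
      _ = _ := by congr 2; ring

set_option maxHeartbeats 1000000 in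
/-- Overshooting the time `M ^ β / η` is exponentially unlikely in `M`, even when weighted with the
variance accumulated up to the next time of the grid. -/
theorem exists_overshoot_bound (hβ : 1 < β) (hα0 : 0 < α) (hα2 : 1 < 2 * (β * α))
    (hα1 : β * α < 1) (hc : 0 < c) (hC : 0 < C) (ha : 0 < a) (hL : 0 < L) :
    ∃ κ > 0, ∃ K > 0, ∃ d > 0, ∀ {n : ℕ} {μ : Fin n → ℝ} {p : Fin n → ℕ} {r : ℕ}
      {γ : ℝ → Fin n → ℝ} {η Q : ℝ} {θ : Fin n → ℝ},
      IsPolySpectrum μ p r c C β → IsShrinkageFamily γ μ r a η L β → MemEllipsoid θ μ Q →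
      ∀ {M : ℕ}, 1 ≤ M → M ≤ r → κ * Q ≤ (M : ℝ) ^ (β + 1) →
        ∃ D : (Fin n → ℝ) → ℝ, HasMeanLE D (K * (M * Real.exp (-d * M))) ∧ (∀ z, 0 ≤ D z) ∧
          ∀ z, ∑ i, μ i ^ α < ∑ i, μ i ^ α * (1 - γ ((M : ℝ) ^ β / η) i) ^ 2 * (θ i + z i) ^ 2 →
            ∑ i, min 1 (((M + 1 : ℕ) : ℝ) ^ β * μ i) * z i ^ 2 ≤ D z := by
  obtain ⟨KW, hKW, hW2⟩ := sum_sq_resid_le (a := a) hβ hα0 hα2 hα1 hc hC hL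
  set k₀ := c ^ α * min 1 c with hk₀
  have hk₀pos : 0 < k₀ := mul_pos (Real.rpow_pos_of_pos hc _) (lt_min one_pos hc)
  set K₁ := C ^ (0 : ℝ) / (1 - β * 0) + C ^ ((0 : ℝ) + 1) / (β * (0 + 1) - 1) with hK₁
  have hK₁pos : 0 < K₁ := by
    have : 0 < β * (0 + 1) - 1 := by linarith
    have : 0 < 1 - β * 0 := by linarith
    positivity
  -- The first bound keeps the quadratic coefficients below `1 / 4`, as the Gaussian exponential
  -- moment requires. The second makes the quadratic error at most a quarter of the negative drift
  -- `δ * a * k₀ * M`.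
  set δ := min (1 / (4 * (L ^ α + 1))) (a * k₀ / (16 * KW)) with hδ
  have hLα : 0 < L ^ α := Real.rpow_pos_of_pos hL _
  have hδpos : 0 < δ := lt_min (by positivity) (by positivity)
  have hδ1 : δ * (L ^ α + 1) ≤ 1 / 4 := by
    have := min_le_left (1 / (4 * (L ^ α + 1))) (a * k₀ / (16 * KW))
    rw [← hδ, le_div_iff₀ (by positivity)] at this
    linarith
  have hδ2 : 4 * δ * KW ≤ a * k₀ / 4 := by
    have := min_le_right (1 / (4 * (L ^ α + 1))) (a * k₀ / (16 * KW))
    rw [← hδ, le_div_iff₀ (by positivity)] at this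
    linarith
  -- Chosen so that the signal costs another quarter of the drift, leaving `δ * a * k₀ / 2`.
  set κ := 8 * L ^ (1 + α) / (a * k₀) with hκ
  have hκpos : 0 < κ := by positivity
  refine ⟨κ, hκpos, δ⁻¹ * Real.exp (2 * δ * K₁ + 8 * δ ^ 2 * K₁), by positivity, δ * a * k₀ / 2,
    by positivity, ?_⟩
  intro n μ p r γ η Q θ hμ hγ hθ M hM hMr hQ
  have hM1 : (1 : ℝ) ≤ M := by exact_mod_cast hM
  have hM0 : (0 : ℝ) < M := by linarith
  have hn := hμ.nonneg hc
  have hα : α ≤ 1 := by nlinarith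
  set Γ := γ ((M : ℝ) ^ β / η) with hΓ
  set W : Fin n → ℝ := fun i => μ i ^ α * (1 - Γ i) ^ 2 with hW
  set V : Fin n → ℝ := fun i => min 1 (((M + 1 : ℕ) : ℝ) ^ β * μ i) with hV
  -- The Chernoff parameter: the largest order for which `l * W i` stays bounded.
  set l := δ * (M : ℝ) ^ (β * α) with hl
  have hX : 0 < (M : ℝ) ^ (β * α) := Real.rpow_pos_of_pos hM0 _
  have hlpos : 0 < l := by positivity
  have hWnn : ∀ i, 0 ≤ W i := fun i => mul_nonneg (Real.rpow_nonneg (hn i) _) (sq_nonneg _)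
  have hVnn : ∀ i, 0 ≤ V i := fun i => le_min zero_le_one (mul_nonneg (by positivity) (hn i))
  have hV1 : ∀ i, V i ≤ 1 := fun i => min_le_left _ _
  have hlW : ∀ i, l * W i ≤ δ * L ^ α := by
    intro i
    have := hγ.resid_rpow_le hn hL.le hα0.le (by linarith) hM hMr i
    calc l * W i ≤ l * (L ^ α * (M : ℝ) ^ (-(β * α))) := mul_le_mul_of_nonneg_left this hlpos.le
      _ = δ * L ^ α * ((M : ℝ) ^ (β * α) * (M : ℝ) ^ (-(β * α))) := by rw [hl]; ring
      _ = δ * L ^ α := by rw [← Real.rpow_add hM0]; simp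
  have hsumV : ∑ i, V i ≤ 2 * K₁ * M := by
    have := hμ.sum_rpow_mul_min_le hc hC.le hβ (q := 0) le_rfl (by simp) (M := M + 1) (by omega)
    simp only [Real.rpow_zero, one_mul] at this
    rw [← hV] at this
    refine this.trans ?_
    rw [mul_zero, sub_zero, Real.rpow_one]
    push_cast
    have e : (1 / 1 + C ^ ((0 : ℝ) + 1) / (β * (0 + 1) - 1)) = K₁ := by simp [hK₁]
    rw [e]
    nlinarith
  have hdV : ∀ i, δ / M * V i ≤ δ := fun i => by
    calc δ / M * V i ≤ δ / M * 1 := mul_le_mul_of_nonneg_left (hV1 i) (by positivity)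
      _ ≤ δ := by rw [mul_one]; exact div_le_self hδpos.le hM1
  have hAnn : ∀ i, 0 ≤ l * W i + δ / M * V i := fun i =>
    add_nonneg (mul_nonneg hlpos.le (hWnn i)) (mul_nonneg (by positivity) (hVnn i))
  have hA : ∀ i, |l * W i + δ / M * V i| ≤ 1 / 4 := fun i => by
    rw [abs_of_nonneg (hAnn i)]
    linarith [hlW i, hdV i]
  have hlW' : ∀ i, l * W i ≤ 1 / 4 := fun i => by
    have := hlW i
    nlinarith
  -- The drift: the smoothed variance already removed at this time is at least of order `M ^ (1 - β
  -- α)`, so the expected noise part of the risk lies below its level by that amount.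
  have hmain : ∑ i, (l * W i - l * μ i ^ α) ≤ -(δ * a * k₀ * M) := by
    have h1 : ∀ i, l * W i - l * μ i ^ α
        ≤ -(l * a) * (μ i ^ α * min 1 ((M : ℝ) ^ β * μ i)) := by
      intro i
      clear_value κ K₁ δ l
      have hU : 0 ≤ μ i ^ α := Real.rpow_nonneg (hn i) _
      have h2 := hγ.lower_time hM i
      have h3 : (1 - Γ i) ^ 2 ≤ 1 - Γ i := by
        have := hγ.nonneg ((M : ℝ) ^ β / η) i
        have := hγ.le_one ((M : ℝ) ^ β / η) i
        rw [← hΓ] at *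
        nlinarith
      have h4 : (1 - Γ i) ^ 2 - 1 ≤ -(a * min 1 ((M : ℝ) ^ β * μ i)) := by linarith
      have := mul_le_mul_of_nonneg_left h4 (mul_nonneg hlpos.le hU)
      simp only [hW]
      linarith
    refine (Finset.sum_le_sum fun i _ => h1 i).trans ?_
    rw [← Finset.mul_sum]
    have h5 := hμ.le_sum_rpow_mul_min hc (by linarith) hα0.le hM hMr
    have h6 : l * (M : ℝ) ^ (1 - β * α) = δ * M := by
      rw [hl, mul_assoc, ← Real.rpow_add hM0]; simp
    have h7 := mul_le_mul_of_nonneg_left h5 (mul_nonneg hlpos.le ha.le)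
    rw [← hk₀] at h7
    have h8 : l * a * (k₀ * (M : ℝ) ^ (1 - β * α)) = a * k₀ * (l * (M : ℝ) ^ (1 - β * α)) := by ring
    rw [h8, h6] at h7
    linarith
  have hquad : ∑ i, 2 * (l * W i + δ / M * V i) ^ 2 ≤ δ * (a * k₀ / 4) * M + 8 * δ ^ 2 * K₁ := by
    have h1 : ∀ i, 2 * (l * W i + δ / M * V i) ^ 2
        ≤ 4 * l ^ 2 * W i ^ 2 + 4 * (δ / M) ^ 2 * V i := by
      intro i
      have hV2 : V i ^ 2 ≤ V i := pow_le_of_le_one (hVnn i) (hV1 i) two_ne_zero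
      calc 2 * (l * W i + δ / M * V i) ^ 2 ≤ 2 * (2 * ((l * W i) ^ 2 + (δ / M * V i) ^ 2)) := by
            gcongr; exact add_sq_le
        _ = 4 * l ^ 2 * W i ^ 2 + 4 * ((δ / M) ^ 2 * V i ^ 2) := by ring
        _ ≤ 4 * l ^ 2 * W i ^ 2 + 4 * ((δ / M) ^ 2 * V i) := by gcongr
        _ = _ := by ring
    refine (Finset.sum_le_sum fun i _ => h1 i).trans ?_
    rw [Finset.sum_add_distrib, ← Finset.mul_sum, ← Finset.mul_sum]
    refine add_le_add ?_ ?_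
    · have h2 := hW2 hμ hγ hM hMr
      have h3 : l ^ 2 * (M : ℝ) ^ (1 - 2 * (β * α)) = δ ^ 2 * M := by
        rw [hl, mul_pow, ← Real.rpow_natCast ((M : ℝ) ^ (β * α)) 2, ← Real.rpow_mul hM0.le,
          mul_assoc, ← Real.rpow_add hM0]
        push_cast
        rw [show β * α * 2 + (1 - 2 * (β * α)) = 1 by ring, Real.rpow_one]
      calc 4 * l ^ 2 * ∑ i, W i ^ 2 ≤ 4 * l ^ 2 * (KW * (M : ℝ) ^ (1 - 2 * (β * α))) :=
            mul_le_mul_of_nonneg_left h2 (by positivity)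
        _ = 4 * KW * (l ^ 2 * (M : ℝ) ^ (1 - 2 * (β * α))) := by ring
        _ = δ * (4 * δ * KW) * M := by rw [h3]; ring
        _ ≤ _ := by gcongr
    · calc 4 * (δ / M) ^ 2 * ∑ i, V i ≤ 4 * (δ / M) ^ 2 * (2 * K₁ * M) :=
            mul_le_mul_of_nonneg_left hsumV (by positivity)
        _ = 8 * δ ^ 2 * K₁ / M := by field_simp; ring
        _ ≤ _ := div_le_self (by positivity) hM1
  have hsig : ∑ i, ((2 * l * W i * θ i) ^ 2 + l * W i * θ i ^ 2) ≤ δ * (a * k₀ / 4) * M := by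
    have h1 : ∀ i, (2 * l * W i * θ i) ^ 2 + l * W i * θ i ^ 2 ≤ 2 * l * (W i * θ i ^ 2) := by
      intro i
      have h2 : 0 ≤ l * W i * θ i ^ 2 := mul_nonneg (mul_nonneg hlpos.le (hWnn i)) (sq_nonneg _)
      have h3 := mul_le_mul_of_nonneg_right (hlW' i) h2
      nlinarith
    refine (Finset.sum_le_sum fun i _ => h1 i).trans ?_
    rw [← Finset.mul_sum]
    have h4 : ∑ i, W i * θ i ^ 2 ≤ L ^ (1 + α) * (M : ℝ) ^ (-(β * (1 + α))) * Q := by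
      refine hθ.sum_mul_sq_le hn _ (by positivity) fun i _ hi => ?_
      have := hγ.resid_rpow_le hn hL.le (q := 1 + α) (by linarith) (by linarith) hM hMr i
      rw [Real.rpow_add hi, Real.rpow_one] at this
      simp only [hW]
      linarith
    have h5 : Q ≤ κ⁻¹ * (M : ℝ) ^ (β + 1) := by
      rw [← div_eq_inv_mul, le_div_iff₀ hκpos]; linarith
    calc 2 * l * ∑ i, W i * θ i ^ 2
        ≤ 2 * l * (L ^ (1 + α) * (M : ℝ) ^ (-(β * (1 + α))) * (κ⁻¹ * (M : ℝ) ^ (β + 1))) := by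
          gcongr
          exact h4.trans (mul_le_mul_of_nonneg_left h5 (by positivity))
      _ = 2 * δ * L ^ (1 + α) * κ⁻¹ *
          ((M : ℝ) ^ (β * α) * (M : ℝ) ^ (-(β * (1 + α))) * (M : ℝ) ^ (β + 1)) := by rw [hl]; ring
      _ = 2 * δ * L ^ (1 + α) * κ⁻¹ * M := by
          rw [← Real.rpow_add hM0, ← Real.rpow_add hM0,
            show β * α + -(β * (1 + α)) + (β + 1) = 1 by ring, Real.rpow_one]
      _ = δ * (a * k₀ / 4) * M := by rw [hκ]; field_simp; ring
  have htotal : ∑ i, ((l * W i + δ / M * V i) + 2 * (l * W i + δ / M * V i) ^ 2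
      + (2 * l * W i * θ i) ^ 2) + ∑ i, (l * W i * θ i ^ 2 - l * μ i ^ α)
      ≤ (2 * δ * K₁ + 8 * δ ^ 2 * K₁) + -(δ * a * k₀ / 2) * M := by
    have h1 : ∑ i, δ / M * V i ≤ 2 * δ * K₁ := by
      rw [← Finset.mul_sum]
      calc δ / M * ∑ i, V i ≤ δ / M * (2 * K₁ * M) :=
            mul_le_mul_of_nonneg_left hsumV (by positivity)
        _ = 2 * δ * K₁ := by field_simp
    simp only [Finset.sum_add_distrib, Finset.sum_sub_distrib] at hmain hquad hsig h1 ⊢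
    linarith
  -- On the overshoot event the Chernoff exponent is nonnegative, so `x ≤ exp x` applied to `δ / M`
  -- times the variance sum gives the majorant. The tilt `δ / M` is small enough to cost only a
  -- constant factor, because the weights `V i` sum to order `M`.
  refine ⟨fun z => δ⁻¹ * M * Real.exp (∑ i, ((l * W i + δ / M * V i) * z i ^ 2
    + (2 * l * W i * θ i) * z i) + ∑ i, (l * W i * θ i ^ 2 - l * μ i ^ α)), ?_, ?_, ?_⟩
  · refine ((HasMeanLE.exp_quadratic (b := (2 * δ * K₁ + 8 * δ ^ 2 * K₁) + -(δ * a * k₀ / 2) * M) hA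
      htotal).const_mul (k := δ⁻¹ * M) (by positivity)).mono (le_of_eq ?_)
    rw [Real.exp_add]; ring
  · intro z; positivity
  · intro z hz
    have h1 : ∑ i, ((l * W i + δ / M * V i) * z i ^ 2 + (2 * l * W i * θ i) * z i)
        + ∑ i, (l * W i * θ i ^ 2 - l * μ i ^ α)
        = l * (∑ i, W i * (θ i + z i) ^ 2 - ∑ i, μ i ^ α) + δ / M * ∑ i, V i * z i ^ 2 := by
      rw [← Finset.sum_sub_distrib, Finset.mul_sum, Finset.mul_sum, ← Finset.sum_add_distrib,
        ← Finset.sum_add_distrib]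
      exact Finset.sum_congr rfl fun i _ => by ring
    beta_reduce
    rw [h1]
    have h2 : 0 ≤ l * (∑ i, W i * (θ i + z i) ^ 2 - ∑ i, μ i ^ α) :=
      mul_nonneg hlpos.le (sub_nonneg.2 hz.le)
    set S := ∑ i, V i * z i ^ 2
    calc S = δ⁻¹ * M * (δ / M * S) := by field_simp
      _ ≤ δ⁻¹ * M * Real.exp (l * (∑ i, W i * (θ i + z i) ^ 2 - ∑ i, μ i ^ α) + δ / M * S) := by
        refine mul_le_mul_of_nonneg_left ?_ (by positivity)
        have := Real.add_one_le_exp (l * (∑ i, W i * (θ i + z i) ^ 2 - ∑ i, μ i ^ α) + δ / M * S)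
        linarith

end Upper

theorem IsShrinkageFamily.eq_zero {n : ℕ} {γ : ℝ → Fin n → ℝ} {μ : Fin n → ℝ} {r : ℕ}
    {a η L β : ℝ} (h : IsShrinkageFamily γ μ r a η L β) {i : Fin n} (hi : μ i = 0) (t : ℝ) :
    γ t i = 0 := by
  refine le_antisymm ?_ (h.nonneg t i)
  -- The upper bound on `γ` is available only at positive times; monotonicity covers the others.
  have h1 : γ t i ≤ γ (max t 1) i := h.mono i (le_max_left t 1)
  have h2 := h.upper (max t 1) (by positivity) i
  rw [hi, mul_zero] at h2
  exact h1.trans (h2.trans (min_le_right _ _))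

section Upper

variable {α β c C a L : ℝ}

/-- On the nonzero spectrum the weights `μ i ^ α` are at least of order `r ^ (-βα)`, while their sum
is at most of order `r ^ (1 - βα)`. Removing the weights from the stopping inequality thus costs
order `r`, whatever the radius of the ellipsoid. -/
theorem exists_loss_bound_rank (hβ : 1 < β) (hα0 : 0 < α) (hα1 : β * α < 1) (hc : 0 < c)
    (hC : 0 < C) :
    ∃ K > 0, ∀ {n : ℕ} {μ : Fin n → ℝ} {p : Fin n → ℕ} {r : ℕ} {γ : ℝ → Fin n → ℝ} {η Q : ℝ}
      {θ : Fin n → ℝ} {τ : (Fin n → ℝ) → ℝ},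
      IsPolySpectrum μ p r c C β → IsShrinkageFamily γ μ r a η L β → MemEllipsoid θ μ Q →
      IsStoppingRule γ μ α τ →
      ∫⁻ z, ENNReal.ofReal (∑ i, (γ (τ fun j => θ j + z j) i * (θ i + z i) - θ i) ^ 2) ∂(stdNoise n)
        ≤ ENNReal.ofReal (K * r) := by
  have hd : 0 < 1 - β * α := by linarith
  refine ⟨8 * (c ^ α)⁻¹ * (C ^ α / (1 - β * α)) + 2, by positivity, ?_⟩
  intro n μ p r γ η Q θ τ hμ hγ hθ hτ
  have hn := hμ.nonneg hc
  have hU : ∀ i, 0 ≤ μ i ^ α := fun i => Real.rpow_nonneg (hn i) _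
  set b := (c ^ α)⁻¹ * (r : ℝ) ^ (β * α) with hb
  have hb0 : 0 ≤ b := by positivity
  have hSU := hμ.sum_rpow_le_of_lt_one hc hC.le (by linarith) hα0 hα1
  have hbS : b * ∑ i, μ i ^ α ≤ (c ^ α)⁻¹ * (C ^ α / (1 - β * α)) * r := by
    rcases Nat.eq_zero_or_pos r with h0 | h0
    · have : ∑ i, μ i ^ α = 0 := Finset.sum_eq_zero fun i _ => by
        rw [hμ.zero i (by omega), Real.zero_rpow hα0.ne']
      simp [this, h0]
    · have hr : (0 : ℝ) < r := by exact_mod_cast h0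
      calc b * ∑ i, μ i ^ α ≤ b * (C ^ α / (1 - β * α) * (r : ℝ) ^ (1 - β * α)) := by gcongr
        _ = (c ^ α)⁻¹ * (C ^ α / (1 - β * α)) * ((r : ℝ) ^ (β * α) * (r : ℝ) ^ (1 - β * α)) := by
          rw [hb]; ring
        _ = _ := by rw [← Real.rpow_add hr]; simp
  have hG : HasMeanLE (fun z : Fin n → ℝ => 2 * (b * (2 * ∑ i, μ i ^ α + 2 * ∑ i, μ i ^ α * z i ^ 2))
      + 2 * ∑ i with p i < r, 1 * z i ^ 2)
      ((8 * (c ^ α)⁻¹ * (C ^ α / (1 - β * α)) + 2) * r) := by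
    refine ((((HasMeanLE.const _).add ((HasMeanLE.sum_mul_sq _ hU le_rfl).const_mul
      zero_le_two)).const_mul hb0).const_mul zero_le_two |>.add
      ((HasMeanLE.sum_mul_sq (b := r) _ (fun _ => zero_le_one)
        (by simpa using hμ.card_low_le r)).const_mul zero_le_two)).mono ?_
    linarith
  refine hG.lintegral_le (fun z => ?_) fun z => ?_
  · have : 0 ≤ ∑ i, μ i ^ α := Finset.sum_nonneg fun i _ => hU i
    have : 0 ≤ ∑ i, μ i ^ α * z i ^ 2 :=
      Finset.sum_nonneg fun i _ => mul_nonneg (hU i) (sq_nonneg _)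
    have : 0 ≤ ∑ i with p i < r, 1 * z i ^ 2 := Finset.sum_nonneg fun i _ => by positivity
    positivity
  · set t := τ fun j => θ j + z j with ht
    have hT := hτ.risk_le fun j => θ j + z j
    rw [← ht] at hT
    have h1 : ∀ i, (γ t i * (θ i + z i) - θ i) ^ 2 ≤ 2 * (b * (2 * (μ i ^ α * (1 - γ t i) ^ 2 *
        (θ i + z i) ^ 2) + 2 * (μ i ^ α * z i ^ 2))) + 2 * (if p i < r then 1 * z i ^ 2 else 0) := by
      intro i
      have hg0 := hγ.nonneg t i
      have hg1 := hγ.le_one t i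
      have hw1 : (1 - γ t i) ^ 2 ≤ 1 := pow_le_one₀ (by linarith) (by linarith)
      have hv1 : γ t i ^ 2 ≤ 1 := pow_le_one₀ hg0 hg1
      split_ifs with hi
      · have h2 : 1 ≤ b * μ i ^ α := by
          have hr : (0 : ℝ) < r := by exact_mod_cast (by omega : 0 < r)
          have := mul_le_mul_of_nonneg_left (hμ.low_rpow_ge hc (by linarith) hα0.le hi hi) hb0
          refine le_trans (le_of_eq ?_) this
          rw [hb, Real.rpow_neg hr.le]
          have := (Real.rpow_pos_of_pos hc α).ne'
          have := (Real.rpow_pos_of_pos hr (β * α)).ne'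
          field_simp
        have h3 : (1 - γ t i) ^ 2 * θ i ^ 2 ≤ 2 * ((1 - γ t i) ^ 2 * (θ i + z i) ^ 2) + 2 * z i ^ 2 := by
          have e1 : θ i ^ 2 ≤ 2 * (θ i + z i) ^ 2 + 2 * z i ^ 2 := by
            nlinarith [sq_nonneg (θ i + 2 * z i)]
          have := mul_le_mul_of_nonneg_left e1 (sq_nonneg (1 - γ t i))
          have := mul_le_mul_of_nonneg_right hw1 (sq_nonneg (z i))
          linarith
        have h4 : (1 - γ t i) ^ 2 * θ i ^ 2 ≤ b * μ i ^ α *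
            (2 * ((1 - γ t i) ^ 2 * (θ i + z i) ^ 2) + 2 * z i ^ 2) :=
          h3.trans (le_mul_of_one_le_left (by positivity) h2)
        have h5 : (γ t i * (θ i + z i) - θ i) ^ 2
            ≤ 2 * ((1 - γ t i) ^ 2 * θ i ^ 2) + 2 * (γ t i ^ 2 * z i ^ 2) := by
          nlinarith [sq_nonneg ((1 - γ t i) * θ i + γ t i * z i)]
        have h6 := mul_le_mul_of_nonneg_right hv1 (sq_nonneg (z i))
        linarith
      · have h0 := hμ.zero i (not_lt.1 hi)
        rw [hγ.eq_zero h0, hθ.zero i h0, h0, Real.zero_rpow hα0.ne']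
        simp
    refine (Finset.sum_le_sum fun i _ => h1 i).trans ?_
    simp only [Finset.sum_add_distrib, ← Finset.mul_sum, ← Finset.sum_filter]
    gcongr

/-- Stopping late makes the bias small through the residual bound; stopping early makes it small
through the stopping inequality. The majorant `G` is deterministic in time and covers both cases. -/
theorem exists_bias_bound (hβ : 1 < β) (hα0 : 0 < α) (hα2 : 1 < 2 * (β * α)) (hα1 : β * α < 1)
    (hc : 0 < c) (hC : 0 < C) (hL : 0 < L) :
    ∃ K > 0, ∀ {n : ℕ} {μ : Fin n → ℝ} {p : Fin n → ℕ} {r : ℕ} {γ : ℝ → Fin n → ℝ} {η Q : ℝ}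
      {θ : Fin n → ℝ} {τ : (Fin n → ℝ) → ℝ},
      IsPolySpectrum μ p r c C β → IsShrinkageFamily γ μ r a η L β → MemEllipsoid θ μ Q →
      IsStoppingRule γ μ α τ → ∀ {m : ℕ}, 1 ≤ m → m ≤ r → Q ≤ (m : ℝ) ^ (β + 1) →
      ∃ G : (Fin n → ℝ) → ℝ, HasMeanLE G (K * m) ∧ (∀ z, 0 ≤ G z) ∧
        ∀ z, ∑ i, (1 - γ (τ fun j => θ j + z j) i) ^ 2 * θ i ^ 2 ≤ G z := by
  have hd : 0 < 1 - β * α := by linarith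
  have hd2 : 0 < β * (2 * α) - 1 := by linarith
  have hd3 : 0 < β * (α + 1) - 1 := by nlinarith
  set K₂ := C ^ α / (1 - β * α) + C ^ (α + 1) / (β * (α + 1) - 1) with hK₂
  set K₄ := C ^ (2 * α) + C ^ (2 * α) / (β * (2 * α) - 1) with hK₄
  set K₆ := C ^ α / (1 - β * α) with hK₆
  have hCα : 0 < C ^ α := Real.rpow_pos_of_pos hC _
  -- Since `μ i ≤ C`, this makes `δ * μ i ^ α ≤ 1 / 4`.
  set δ := 1 / (4 * C ^ α) with hδ
  have hδ0 : 0 < δ := by positivity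
  set N := 2 * (δ⁻¹ * (Real.exp (2 * δ ^ 2 * K₄) + Real.exp (2 * δ ^ 2 * K₄))) with hN
  set N' := 4 * (Real.exp (C ^ (2 * α + 1)) + Real.exp (C ^ (2 * α + 1))) with hN'
  refine ⟨L + C + (c ^ α)⁻¹ * (N + 8 * K₂ + 4 * K₆ + N' + 2 * C ^ (α + 1)), by positivity, ?_⟩
  intro n μ p r γ η Q θ τ hμ hγ hθ hτ m hm hmr hQ
  have hn := hμ.nonneg hc
  have hU : ∀ i, 0 ≤ μ i ^ α := fun i => Real.rpow_nonneg (hn i) _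
  have hm1 : (1 : ℝ) ≤ m := by exact_mod_cast hm
  have hm0 : (0 : ℝ) < m := by linarith
  have hQ0 : 0 ≤ Q := hθ.radius_nonneg hn
  set Γ := γ ((m : ℝ) ^ β / η) with hΓ
  set X := (m : ℝ) ^ (β * α) with hX
  have hX0 : 0 < X := Real.rpow_pos_of_pos hm0 _
  have hXm : X ≤ m := by
    calc X ≤ (m : ℝ) ^ (1 : ℝ) := Real.rpow_le_rpow_of_exponent_le hm1 hα1.le
      _ = m := Real.rpow_one _
  have hXY : X * (m : ℝ) ^ (1 - β * α) = m := by
    rw [hX, ← Real.rpow_add hm0]; simp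
  have hhigh : ∀ q : ℝ, 0 ≤ q → ∀ i, ¬ p i < m → μ i ^ q ≤ C ^ q * (m : ℝ) ^ (-(β * q)) := by
    intro q hq i hi
    have := Real.rpow_le_rpow (hn i) (hμ.le_of_le hC.le (by linarith) hm (i := i) (by omega)) hq
    rwa [Real.mul_rpow hC.le (by positivity), ← Real.rpow_mul hm0.le, neg_mul] at this
  -- squared high-frequency signal
  have hsig : ∀ q : ℝ, 0 ≤ q → ∑ i with ¬ p i < m, μ i ^ q * θ i ^ 2
      ≤ C ^ (q + 1) * (m : ℝ) ^ (1 - β * q) := by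
    intro q hq
    refine (hθ.sum_mul_sq_le hn _ (b := C ^ (q + 1) * (m : ℝ) ^ (-(β * (q + 1)))) (by positivity)
      fun i hi hpos => ?_).trans ?_
    · rw [← Real.rpow_add_one hpos.ne']
      exact hhigh _ (by linarith) i (by simpa using hi)
    · calc C ^ (q + 1) * (m : ℝ) ^ (-(β * (q + 1))) * Q
          ≤ C ^ (q + 1) * (m : ℝ) ^ (-(β * (q + 1))) * (m : ℝ) ^ (β + 1) := by gcongr
        _ = _ := by rw [mul_assoc, ← Real.rpow_add hm0]; congr 2; ring
  have hnoise := HasMeanLE.abs_sum_sq_sub_one (w := fun i => μ i ^ α) (K := 2 * δ ^ 2 * K₄) hδ0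
    (fun i => by
      have h1 : μ i ≤ C := by simpa using hμ.le_of_le hC.le (by linarith) le_rfl (i := i) (by omega)
      have h2 := Real.rpow_le_rpow (hn i) h1 hα0.le
      rw [abs_of_nonneg (mul_nonneg hδ0.le (hU i)), hδ, div_mul_eq_mul_div, one_mul,
        div_le_div_iff₀ (by positivity) (by norm_num)]
      linarith)
    (by
      have h1 := hμ.sum_rpow_le_of_one_lt hc hC.le (by linarith) (q := 2 * α) (by linarith)
        (by linarith)
      have h2 : ∀ i, 2 * (δ * μ i ^ α) ^ 2 = 2 * δ ^ 2 * μ i ^ (2 * α) := fun i => by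
        rw [mul_comm 2 α, Real.rpow_mul (hn i), Real.rpow_two]; ring
      simp only [h2, ← Finset.mul_sum]
      gcongr)
  have hlin := HasMeanLE.abs_sum_linear (w := fun i => if p i < m then 0 else μ i ^ α * θ i)
    (K := C ^ (2 * α + 1)) (by
      have h1 : ∀ i, (if p i < m then 0 else μ i ^ α * θ i) ^ 2
          = if ¬ p i < m then μ i ^ (2 * α) * θ i ^ 2 else 0 := fun i => by
        rw [mul_comm 2 α, Real.rpow_mul (hn i), Real.rpow_two]
        split_ifs <;> ring
      simp only [h1, ← Finset.sum_filter]
      refine (hsig (2 * α) (by linarith)).trans (mul_le_of_le_one_right (by positivity) ?_)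
      exact Real.rpow_le_one_of_one_le_of_nonpos hm1 (by linarith))
  have hΓ1 : ∀ i, Γ i ≤ 1 := hγ.le_one _
  have hΓ0 : ∀ i, 0 ≤ Γ i := hγ.nonneg _
  have hvar := HasMeanLE.sum_mul_sq (b := K₂ * (m : ℝ) ^ (1 - β * α)) Finset.univ
    (w := fun i => μ i ^ α * Γ i) (fun i => mul_nonneg (hU i) (hΓ0 i)) (by
      refine le_trans (Finset.sum_le_sum fun i _ => ?_)
        (hμ.sum_rpow_mul_min_le hc hC.le hβ hα0.le hα1 hm)
      exact mul_le_mul_of_nonneg_left (hγ.upper_time hm i) (hU i))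
  have hlow := HasMeanLE.sum_mul_sq (b := K₆ * (m : ℝ) ^ (1 - β * α))
    (Finset.univ.filter fun i => p i < m) (w := fun i => μ i ^ α) hU
    (hμ.sum_low_rpow_le hc hC.le (by linarith) hα0.le hα1 m)
  have hb0 : 0 ≤ (c ^ α)⁻¹ * X := by positivity
  refine ⟨_, ((HasMeanLE.const ((L + C) * m)).add ((((((hnoise.1.const_mul zero_le_two).add
    (hvar.const_mul (k := 8) (by norm_num))).add (hlow.const_mul (k := 4) (by norm_num))).add
    (hlin.1.const_mul (k := 4) (by norm_num))).add
    (HasMeanLE.const (2 * (C ^ (α + 1) * (m : ℝ) ^ (1 - β * α))))).const_mul hb0)).mono ?_, ?_, ?_⟩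
  · have h1 : (c ^ α)⁻¹ * X * N ≤ (c ^ α)⁻¹ * N * m := by
      rw [mul_right_comm]; gcongr
    have h2 : (c ^ α)⁻¹ * X * N' ≤ (c ^ α)⁻¹ * N' * m := by
      rw [mul_right_comm]; gcongr
    have h3 : (c ^ α)⁻¹ * X * (8 * (K₂ * (m : ℝ) ^ (1 - β * α)) + 4 * (K₆ * (m : ℝ) ^ (1 - β * α))
        + 2 * (C ^ (α + 1) * (m : ℝ) ^ (1 - β * α)))
        = (c ^ α)⁻¹ * (8 * K₂ + 4 * K₆ + 2 * C ^ (α + 1)) * (X * (m : ℝ) ^ (1 - β * α)) := by ring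
    rw [hXY] at h3
    linarith
  · intro z
    have h1 : 0 ≤ ∑ i, μ i ^ α * Γ i * z i ^ 2 := Finset.sum_nonneg fun i _ =>
      mul_nonneg (mul_nonneg (hU i) (hΓ0 i)) (sq_nonneg _)
    have h2 : 0 ≤ ∑ i with p i < m, μ i ^ α * z i ^ 2 := Finset.sum_nonneg fun i _ =>
      mul_nonneg (hU i) (sq_nonneg _)
    positivity
  · intro z
    set t := τ fun j => θ j + z j with ht
    have hT := hτ.risk_le fun j => θ j + z j
    rw [← ht] at hT
    have h1 : 0 ≤ ∑ i, μ i ^ α * Γ i * z i ^ 2 := Finset.sum_nonneg fun i _ =>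
      mul_nonneg (mul_nonneg (hU i) (hΓ0 i)) (sq_nonneg _)
    have h2 : 0 ≤ ∑ i with p i < m, μ i ^ α * z i ^ 2 := Finset.sum_nonneg fun i _ =>
      mul_nonneg (hU i) (sq_nonneg _)
    have hrate : (m : ℝ) ^ (-β) * Q ≤ m := by
      calc (m : ℝ) ^ (-β) * Q ≤ (m : ℝ) ^ (-β) * (m : ℝ) ^ (β + 1) := by gcongr
        _ = m := by rw [← Real.rpow_add hm0]; simp
    have hone : ∀ i, (1 - γ t i) ^ 2 ≤ 1 := fun i =>
      pow_le_one₀ (sub_nonneg.2 (hγ.le_one t i)) (sub_le_self _ (hγ.nonneg t i))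
    -- Late stopping uses the residual at time `m ^ β / η`. Early stopping bounds the high
    -- frequencies by the ellipsoid alone and the low ones by the stopping inequality.
    rcases le_total ((m : ℝ) ^ β / η) t with hle | hle
    · refine le_add_of_le_of_nonneg ?_ (by positivity)
      have h3 : ∑ i, (1 - γ t i) ^ 2 * θ i ^ 2 ≤ L * (m : ℝ) ^ (-β) * Q := by
        refine hθ.sum_mul_sq_le hn _ (by positivity) fun i _ hi => ?_
        refine le_trans ?_ (hγ.resid m hm hmr i)
        have h4 : γ ((m : ℝ) ^ β / η) i ≤ γ t i := hγ.mono i hle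
        have h5 := hγ.le_one t i
        have h6 := hγ.nonneg t i
        refine mul_le_mul_of_nonneg_right ?_ hi.le
        nlinarith
      have := mul_le_mul_of_nonneg_left hrate hL.le
      have := mul_nonneg hC.le hm0.le
      linarith
    · rw [← Finset.sum_filter_add_sum_filter_not _ (fun i => p i < m), add_comm]
      refine add_le_add ?_ ?_
      · have h3 : ∑ i with ¬ p i < m, (1 - γ t i) ^ 2 * θ i ^ 2 ≤ C * (m : ℝ) ^ (-β) * Q := by
          refine hθ.sum_mul_sq_le hn _ (by positivity) fun i hi hpos => ?_
          refine (mul_le_of_le_one_left hpos.le (hone i)).trans ?_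
          have : ¬ p i < m := by simpa using hi
          exact hμ.le_of_le hC.le (by linarith) hm (by omega)
        have := mul_le_mul_of_nonneg_left hrate hC.le
        have := mul_nonneg hL.le hm0.le
        linarith
      · have h3 := sum_low_bias_le (fun i => p i < m) (U := fun i => μ i ^ α) hU (hγ.nonneg t)
          (fun i => hγ.mono i hle) hΓ1 hT
        -- Below index `m` the weights are at least `c ^ α / X`, so removing them costs a factor of
        -- order `X = m ^ (βα)`. This is at most `m` for the fluctuations of order one, and gives
        -- exactly `m` against the terms of order `m ^ (1 - βα)`.
        have h4 : ∑ i with p i < m, (1 - γ t i) ^ 2 * θ i ^ 2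
            ≤ (c ^ α)⁻¹ * X * ∑ i with p i < m, μ i ^ α * (1 - γ t i) ^ 2 * θ i ^ 2 := by
          rw [Finset.mul_sum]
          refine Finset.sum_le_sum fun i hi => ?_
          have hi : p i < m := by simpa using hi
          have h5 := mul_le_mul_of_nonneg_left
            (hμ.low_rpow_ge hc (by linarith) hα0.le hi (by omega)) hb0
          have h6 : (c ^ α)⁻¹ * X * (c ^ α * (m : ℝ) ^ (-(β * α))) = 1 := by
            rw [Real.rpow_neg hm0.le, ← hX]
            have := (Real.rpow_pos_of_pos hc α).ne'
            field_simp
          rw [h6] at h5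
          have := mul_le_mul_of_nonneg_right h5
            (mul_nonneg (sq_nonneg (1 - γ t i)) (sq_nonneg (θ i)))
          linarith
        refine h4.trans (mul_le_mul_of_nonneg_left (h3.trans ?_) hb0)
        have h5 := hnoise.2 z
        have h6 := hlin.2 z
        have h7 := hsig α hα0.le
        linarith

/-- Stopping by `m ^ β / η` gives variance of order `m`. Otherwise the variance up to the next grid
time is charged to the overshoot of the last grid time passed, and the expected charges `M * exp (-d
M)` are summable. -/
theorem exists_variance_bound (hβ : 1 < β) (hα0 : 0 < α) (hα2 : 1 < 2 * (β * α))
    (hα1 : β * α < 1) (hc : 0 < c) (hC : 0 < C) (ha : 0 < a) (hL : 0 < L) :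
    ∃ κ > 0, ∃ K > 0, ∀ {n : ℕ} {μ : Fin n → ℝ} {p : Fin n → ℕ} {r : ℕ} {γ : ℝ → Fin n → ℝ}
      {η Q : ℝ} {θ : Fin n → ℝ} {τ : (Fin n → ℝ) → ℝ},
      IsPolySpectrum μ p r c C β → IsShrinkageFamily γ μ r a η L β → MemEllipsoid θ μ Q →
      IsStoppingRule γ μ α τ → ∀ {m : ℕ}, 1 ≤ m → m ≤ r → κ * Q ≤ (m : ℝ) ^ (β + 1) →
      ∃ G : (Fin n → ℝ) → ℝ, HasMeanLE G (K * m) ∧ (∀ z, 0 ≤ G z) ∧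
        ∀ z, ∑ i, γ (τ fun j => θ j + z j) i ^ 2 * z i ^ 2 ≤ G z := by
  obtain ⟨κ, hκ, K₀, hK₀, d, hd, H⟩ := exists_overshoot_bound hβ hα0 hα2 hα1 hc hC ha hL
  set K₁ := C ^ (0 : ℝ) / (1 - β * 0) + C ^ ((0 : ℝ) + 1) / (β * (0 + 1) - 1) with hK₁
  have hK₁pos : 0 < K₁ := by
    have : 0 < β * (0 + 1) - 1 := by linarith
    have : 0 < 1 - β * 0 := by linarith
    positivity
  have hsum : Summable fun M : ℕ => (M : ℝ) * Real.exp (-d * M) := by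
    simpa using Real.summable_pow_mul_exp_neg_nat_mul 1 hd
  set T := ∑' M : ℕ, (M : ℝ) * Real.exp (-d * M) with hT
  have hT0 : 0 ≤ T := tsum_nonneg fun M => by positivity
  have hc1 : 0 < min 1 c := lt_min one_pos hc
  refine ⟨κ, hκ, (min 1 c)⁻¹ * (K₁ + K₀ * T), by positivity, ?_⟩
  intro n μ p r γ η Q θ τ hμ hγ hθ hτ m hm hmr hQ
  have hn := hμ.nonneg hc
  have hm1 : (1 : ℝ) ≤ m := by exact_mod_cast hm
  have hex : ∀ M : ℕ, ∃ D : (Fin n → ℝ) → ℝ, M ∈ Finset.Icc m r →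
      HasMeanLE D (K₀ * (M * Real.exp (-d * M))) ∧ (∀ z, 0 ≤ D z) ∧
          ∀ z, ∑ i, μ i ^ α < ∑ i, μ i ^ α * (1 - γ ((M : ℝ) ^ β / η) i) ^ 2 * (θ i + z i) ^ 2 →
            ∑ i, min 1 (((M + 1 : ℕ) : ℝ) ^ β * μ i) * z i ^ 2 ≤ D z := by
    intro M
    by_cases hM : M ∈ Finset.Icc m r
    · obtain ⟨h1, h2⟩ := Finset.mem_Icc.1 hM
      obtain ⟨D, hD⟩ := H hμ hγ hθ (hm.trans h1) h2 (hQ.trans (Real.rpow_le_rpow (by positivity)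
        (by exact_mod_cast h1) (by linarith)))
      exact ⟨D, fun _ => hD⟩
    · exact ⟨0, fun h => absurd h hM⟩
  choose D hD using hex
  have hV0 : ∀ (M : ℕ) (i), 0 ≤ min 1 ((M : ℝ) ^ β * μ i) := fun M i =>
    le_min zero_le_one (mul_nonneg (by positivity) (hn i))
  have hbase := HasMeanLE.sum_mul_sq (b := K₁ * m) Finset.univ
    (w := fun i => min 1 ((m : ℝ) ^ β * μ i)) (hV0 m) (by
      have := hμ.sum_rpow_mul_min_le hc hC.le hβ (q := 0) le_rfl (by simp) hm
      simpa [hK₁] using this)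
  have hDsum0 : ∀ z, 0 ≤ ∑ M ∈ Finset.Icc m r, D M z := fun z =>
    Finset.sum_nonneg fun M hM => (hD M hM).2.1 z
  refine ⟨_, ((hbase.add (HasMeanLE.sum fun M hM => (hD M hM).1)).const_mul
    (k := (min 1 c)⁻¹) (by positivity)).mono ?_, ?_, ?_⟩
  · have h1 : ∑ M ∈ Finset.Icc m r, (M : ℝ) * Real.exp (-d * M) ≤ T :=
      hsum.sum_le_tsum _ fun M _ => by positivity
    rw [← Finset.mul_sum, mul_assoc]
    refine mul_le_mul_of_nonneg_left ?_ (by positivity)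
    have h2 := mul_le_mul_of_nonneg_left h1 hK₀.le
    have h3 : K₀ * T ≤ K₀ * T * m := le_mul_of_one_le_right (by positivity) hm1
    linarith
  · intro z
    have h1 : 0 ≤ ∑ i, min 1 ((m : ℝ) ^ β * μ i) * z i ^ 2 := Finset.sum_nonneg fun i _ =>
      mul_nonneg (hV0 m i) (sq_nonneg _)
    have := hDsum0 z
    positivity
  · intro z
    set t := τ fun j => θ j + z j with ht
    have hsq : ∀ i, γ t i ^ 2 ≤ γ t i := fun i =>
      pow_le_of_le_one (hγ.nonneg t i) (hγ.le_one t i) two_ne_zero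
    have hVs0 : ∀ M : ℕ, 0 ≤ ∑ i, min 1 ((M : ℝ) ^ β * μ i) * z i ^ 2 := fun M =>
      Finset.sum_nonneg fun i _ => mul_nonneg (hV0 M i) (sq_nonneg _)
    have hstep : ∀ M : ℕ, 1 ≤ M → t ≤ (M : ℝ) ^ β / η → ∑ i, γ t i ^ 2 * z i ^ 2
        ≤ (min 1 c)⁻¹ * ∑ i, min 1 ((M : ℝ) ^ β * μ i) * z i ^ 2 := by
      intro M hM hle
      refine le_trans (Finset.sum_le_sum fun i _ => ?_) (le_mul_of_one_le_left (hVs0 M) ?_)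
      · exact mul_le_mul_of_nonneg_right
          ((hsq i).trans ((hγ.mono i hle).trans (hγ.upper_time hM i))) (sq_nonneg _)
      · exact (one_le_inv₀ hc1).2 (min_le_left _ _)
    rcases le_or_gt t ((m : ℝ) ^ β / η) with hle | hlt
    · refine (hstep m hm hle).trans (mul_le_mul_of_nonneg_left ?_ (by positivity))
      linarith [hDsum0 z]
    · classical
      -- The last grid index, capped at `r`, whose time precedes the stopping time; the cap is
      -- needed because the overshoot bound holds only up to the rank.
      set M := Nat.findGreatest (fun M : ℕ => (M : ℝ) ^ β / η < t) r with hMdef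
      have hMt : (M : ℝ) ^ β / η < t :=
        Nat.findGreatest_spec (P := fun M : ℕ => (M : ℝ) ^ β / η < t) hmr hlt
      have hmM : m ≤ M := Nat.le_findGreatest hmr hlt
      have hMr : M ≤ r := Nat.findGreatest_le r
      have hmem : M ∈ Finset.Icc m r := Finset.mem_Icc.2 ⟨hmM, hMr⟩
      have hDM := (hD M hmem).2.2 z
        (hτ.lt_risk (fun j => θ j + z j) _ (hγ.time_pos (hm.trans hmM)) hMt)
      have hkey : ∑ i, γ t i ^ 2 * z i ^ 2
          ≤ (min 1 c)⁻¹ * ∑ i, min 1 (((M + 1 : ℕ) : ℝ) ^ β * μ i) * z i ^ 2 := by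
        rcases lt_or_ge M r with hlt' | hge
        · refine hstep (M + 1) (by omega) (not_lt.1 ?_)
          exact Nat.findGreatest_is_greatest (Nat.lt_succ_self M) hlt'
        -- At `M = r` the next grid time need not bound `t`. But then every nonzero eigenvalue is
        -- saturated: its weight is at least `min 1 c`, while `γ ≤ 1`. This accounts for the factor
        -- `(min 1 c)⁻¹`.
        · rw [Finset.mul_sum]
          refine Finset.sum_le_sum fun i _ => ?_
          rw [← mul_assoc]
          refine mul_le_mul_of_nonneg_right ?_ (sq_nonneg _)
          rcases lt_or_ge (p i) r with hi | hi
          · have h1 := hμ.le_min_one_mul (by linarith) hc hi (M := ((M + 1 : ℕ) : ℝ))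
              (by exact_mod_cast (by omega : p i + 1 ≤ M + 1))
            have h2 : 1 ≤ (min 1 c)⁻¹ * min 1 (((M + 1 : ℕ) : ℝ) ^ β * μ i) := by
              rw [← div_eq_inv_mul, le_div_iff₀ hc1, one_mul]
              exact h1
            exact (pow_le_one₀ (hγ.nonneg t i) (hγ.le_one t i)).trans h2
          · rw [hγ.eq_zero (hμ.zero i hi), zero_pow two_ne_zero]
            exact mul_nonneg (by positivity) (hV0 _ i)
      refine hkey.trans (mul_le_mul_of_nonneg_left ?_ (by positivity))
      have h1 := Finset.single_le_sum (f := fun M => D M z) (fun M hM => (hD M hM).2.1 z) hmem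
      have h2 := hVs0 m
      beta_reduce at h1
      linarith

/-- The risk of the stopped filter in the Gaussian sequence model. -/
theorem exists_loss_bound (hβ : 1 < β) (hα0 : 0 < α) (hα2 : 1 < 2 * (β * α))
    (hα1 : β * α < 1) (hc : 0 < c) (hC : 0 < C) (ha : 0 < a) (hL : 0 < L) :
    ∃ κ > 0, ∃ K > 0, ∀ {n : ℕ} {μ : Fin n → ℝ} {p : Fin n → ℕ} {r : ℕ} {γ : ℝ → Fin n → ℝ}
      {η Q : ℝ} {θ : Fin n → ℝ} {τ : (Fin n → ℝ) → ℝ},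
      IsPolySpectrum μ p r c C β → IsShrinkageFamily γ μ r a η L β → MemEllipsoid θ μ Q →
      IsStoppingRule γ μ α τ → ∀ {m : ℕ}, 1 ≤ m → κ * Q ≤ (m : ℝ) ^ (β + 1) →
      ∫⁻ z, ENNReal.ofReal (∑ i, (γ (τ fun j => θ j + z j) i * (θ i + z i) - θ i) ^ 2) ∂(stdNoise n)
        ≤ ENNReal.ofReal (K * (min m r : ℕ)) := by
  obtain ⟨Ka, hKa, HA⟩ := exists_loss_bound_rank (a := a) (L := L) hβ hα0 hα1 hc hC
  obtain ⟨Kb, hKb, HB⟩ := exists_bias_bound (a := a) hβ hα0 hα2 hα1 hc hC hL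
  obtain ⟨κ, hκ, Kv, hKv, HV⟩ := exists_variance_bound hβ hα0 hα2 hα1 hc hC ha hL
  refine ⟨max 1 κ, by positivity, Ka + (2 * Kb + 2 * Kv), by positivity, ?_⟩
  intro n μ p r γ η Q θ τ hμ hγ hθ hτ m hm hQ
  have hQ0 : 0 ≤ Q := hθ.radius_nonneg (hμ.nonneg hc)
  rcases le_total r m with hrm | hmr
  · refine (HA hμ hγ hθ hτ).trans (ENNReal.ofReal_le_ofReal ?_)
    rw [min_eq_right hrm]
    gcongr
    linarith
  · obtain ⟨G, hG, hG0, hGle⟩ := HB hμ hγ hθ hτ hm hmr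
      (le_trans (le_mul_of_one_le_left hQ0 (le_max_left 1 κ)) hQ)
    obtain ⟨G', hG', hG0', hGle'⟩ := HV hμ hγ hθ hτ hm hmr
      (le_trans (mul_le_mul_of_nonneg_right (le_max_right 1 κ) hQ0) hQ)
    have hsum := (hG.const_mul zero_le_two).add (hG'.const_mul zero_le_two)
    refine (hsum.lintegral_le (fun z => ?_) fun z => ?_).trans (ENNReal.ofReal_le_ofReal ?_)
    · have := hG0 z
      have := hG0' z
      positivity
    · refine le_trans ?_ (add_le_add (mul_le_mul_of_nonneg_left (hGle z) zero_le_two)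
        (mul_le_mul_of_nonneg_left (hGle' z) zero_le_two))
      rw [Finset.mul_sum, Finset.mul_sum, ← Finset.sum_add_distrib]
      refine Finset.sum_le_sum fun i _ => ?_
      set g := γ (τ fun j => θ j + z j) i
      nlinarith [sq_nonneg ((1 - g) * θ i + g * z i)]
    · rw [min_eq_left hmr]
      have : 0 ≤ Ka * (m : ℝ) := by positivity
      linarith

end Upper

/-! ### From the reproducing kernel Hilbert space to the sequence model -/

section Design

variable {X : Type u} (H : Type v) [NormedAddCommGroup H] [InnerProductSpace ℝ H]
  [CompleteSpace H] [RKHS ℝ H X ℝ] {n : ℕ} (x : Fin n → X)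

theorem sum_eigvec_mul_eigvec (i l : Fin n) :
    ∑ j, eigvec H x i j * eigvec H x l j = if i = l then 1 else 0 := by
  have h := orthonormal_iff_ite.1 (gram_isHermitian H x).eigenvectorBasis.orthonormal i l
  rw [PiLp.inner_apply] at h
  simpa [eigvec, mul_comm] using h

theorem sum_eigvec_mul_eigvec' (j k : Fin n) :
    ∑ i, eigvec H x i j * eigvec H x i k = if j = k then 1 else 0 := by
  have h1 : (Matrix.of (eigvec H x)) * (Matrix.of (eigvec H x)).transpose = 1 := by
    ext i l
    simpa [Matrix.mul_apply, Matrix.one_apply] using sum_eigvec_mul_eigvec H x i l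
  have h2 := congrArg (fun A : Matrix (Fin n) (Fin n) ℝ => A j k) (mul_eq_one_comm.1 h1)
  simpa [Matrix.mul_apply, Matrix.one_apply] using h2

theorem sum_gram_mul_eigvec (i j : Fin n) :
    ∑ k, gram H x j k * eigvec H x i k = eigval H x i * eigvec H x i j := by
  have := congrFun ((gram_isHermitian H x).mulVec_eigenvectorBasis i) j
  simpa [Matrix.mulVec, dotProduct, eigvec, eigval] using this

theorem sum_coef_sq (v : Fin n → ℝ) : ∑ i, coef H x v i ^ 2 = ∑ j, v j ^ 2 := by
  have h1 : ∀ i, coef H x v i ^ 2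
      = ∑ j, ∑ k, v j * v k * (eigvec H x i j * eigvec H x i k) := fun i => by
    rw [coef, sq, Finset.sum_mul_sum]
    exact Finset.sum_congr rfl fun j _ => Finset.sum_congr rfl fun k _ => by ring
  simp only [h1]
  rw [Finset.sum_comm]
  refine Finset.sum_congr rfl fun j _ => ?_
  rw [Finset.sum_comm]
  simp only [← Finset.mul_sum, sum_eigvec_mul_eigvec']
  simp [sq]

/-- The vector with coefficients `σ w` in the eigenbasis of the Gram matrix. -/
noncomputable def synth (σ : ℝ) (w : Fin n → ℝ) (j : Fin n) : ℝ := σ * ∑ i, w i * eigvec H x i j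

theorem coef_sub (v w : Fin n → ℝ) (i : Fin n) :
    coef H x (fun j => v j - w j) i = coef H x v i - coef H x w i := by
  simp [coef, mul_sub, Finset.sum_sub_distrib]

theorem coef_synth (σ : ℝ) (w : Fin n → ℝ) (i : Fin n) : coef H x (synth H x σ w) i = σ * w i := by
  have h1 : ∀ j, eigvec H x i j * synth H x σ w j
      = ∑ l, σ * w l * (eigvec H x i j * eigvec H x l j) := fun j => by
    rw [synth, Finset.mul_sum, Finset.mul_sum]
    exact Finset.sum_congr rfl fun l _ => by ring
  rw [coef, Finset.sum_congr rfl fun j _ => h1 j, Finset.sum_comm]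
  simp only [← Finset.mul_sum, sum_eigvec_mul_eigvec]
  simp

theorem synth_coef {σ : ℝ} (hσ : σ ≠ 0) (v : Fin n → ℝ) :
    synth H x σ (fun i => coef H x v i / σ) = v := by
  ext j
  have h1 : ∀ i, coef H x v i / σ * eigvec H x i j
      = σ⁻¹ * ∑ k, v k * (eigvec H x i j * eigvec H x i k) := fun i => by
    rw [coef, div_eq_inv_mul, mul_assoc, Finset.sum_mul]
    congr 1
    exact Finset.sum_congr rfl fun k _ => by ring
  rw [synth, Finset.sum_congr rfl fun i _ => h1 i, ← Finset.mul_sum, Finset.sum_comm]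
  simp only [← Finset.mul_sum, sum_eigvec_mul_eigvec']
  simp [hσ]

theorem synth_add (σ : ℝ) (v w : Fin n → ℝ) :
    synth H x σ (fun i => v i + w i) = fun j => synth H x σ v j + synth H x σ w j := by
  ext j
  simp [synth, add_mul, mul_add, Finset.sum_add_distrib]

theorem measurable_synth (σ : ℝ) : Measurable (synth H x σ) := by
  unfold synth
  fun_prop

/-- Rotation invariance of the standard Gaussian, followed by scaling by `σ`. -/
theorem noise_eq_map (σ : ℝ) : noise n σ = (stdNoise n).map (synth H x σ) := by
  have h1 : stdNoise n = (stdNoise n).map (synth H x 1) := by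
    have h2 := (map_pi_eq_stdGaussian (ι := Fin n)).trans
      (stdGaussian_eq_map_pi_orthonormalBasis (gram_isHermitian H x).eigenvectorBasis)
    have h3 := congrArg (fun ν => ν.map (WithLp.ofLp (p := 2) (V := Fin n → ℝ))) h2
    simp only at h3
    rw [Measure.map_map (by fun_prop) (by fun_prop), Measure.map_map (by fun_prop) (by fun_prop)]
      at h3
    have h4 : (WithLp.ofLp (p := 2) (V := Fin n → ℝ)) ∘ (WithLp.toLp 2) = id := rfl
    rw [h4, Measure.map_id] at h3
    refine h3.trans (congrArg (fun f => Measure.map f (stdNoise n)) ?_)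
    ext w j
    simp [synth, eigvec]
  have h2 : noise n σ = (stdNoise n).map fun w j => σ * w j := by
    rw [noise, stdNoise, Measure.pi_map_pi (f := fun _ y => σ * y) (by fun_prop)]
    congr 1
    ext1 i
    rw [gaussianReal_map_const_mul]
    congr 1
    · simp
    · rw [mul_one]
      ext
      simp [Real.coe_toNNReal _ (sq_nonneg σ)]
  rw [h2, h1, Measure.map_map (by fun_prop) (measurable_synth H x 1), ← h1]
  congr 1
  ext w j
  simp [synth]

/-- The element of `H` whose inner products compute the `i`-th coefficient. -/
noncomputable def feature (i : Fin n) : H := ∑ j, eigvec H x i j • RKHS.kerFun H (x j) (1 : ℝ)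

theorem inner_feature (f : H) (i : Fin n) :
    inner ℝ f (feature H x i) = coef H x (fun j => f (x j)) i := by
  simp [feature, inner_sum, inner_smul_right, coef]

theorem feature_apply (i : Fin n) (z : X) :
    feature H x i z = ∑ j, eigvec H x i j * ker H z (x j) := by
  have h : feature H x i z = inner ℝ (RKHS.kerFun H z (1 : ℝ)) (feature H x i) := by simp
  rw [h, feature, inner_sum]
  refine Finset.sum_congr rfl fun j _ => ?_
  rw [inner_smul_right, RKHS.kerFun_inner, RKHS.kerFun_apply]
  simp [ker]

theorem feature_apply_design (i k : Fin n) :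
    feature H x i (x k) = n * eigval H x i * eigvec H x i k := by
  have hn : (n : ℝ) ≠ 0 := by exact_mod_cast (Fin.pos i).ne'
  rw [feature_apply, mul_assoc, ← sum_gram_mul_eigvec, Finset.mul_sum]
  refine Finset.sum_congr rfl fun j _ => ?_
  simp only [gram, Matrix.of_apply]
  field_simp

/-- The features are orthogonal with squared norms `n μ i`; this identifies the ball of `H` with an
ellipsoid in the coefficients. -/
theorem inner_feature_feature (i l : Fin n) :
    inner ℝ (feature H x i) (feature H x l) = if i = l then n * eigval H x i else 0 := by
  rw [inner_feature, coef]
  have h : ∀ j, eigvec H x l j * feature H x i (x j)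
      = n * eigval H x i * (eigvec H x i j * eigvec H x l j) := fun j => by
    rw [feature_apply_design]; ring
  rw [Finset.sum_congr rfl fun j _ => h j, ← Finset.mul_sum, sum_eigvec_mul_eigvec]
  simp

theorem norm_feature_sq (i : Fin n) : ‖feature H x i‖ ^ 2 = n * eigval H x i := by
  rw [← real_inner_self_eq_norm_sq, inner_feature_feature, if_pos rfl]

theorem eigval_nonneg (i : Fin n) : 0 ≤ eigval H x i := by
  have hn : (0 : ℝ) < n := by exact_mod_cast Fin.pos i
  have := norm_feature_sq H x i
  have h2 : 0 ≤ (n : ℝ) * eigval H x i := by rw [← this]; positivity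
  exact nonneg_of_mul_nonneg_right h2 hn

/-- The trace of the Gram matrix is at most one. This places positive eigenvalues in `(0, 1]`, the
only range on which the filter is controlled. -/
theorem eigval_le_one (hker : ∀ z : X, ker H z z ≤ 1) (i : Fin n) : eigval H x i ≤ 1 := by
  have hn : (0 : ℝ) < n := by exact_mod_cast Fin.pos i
  have h1 : ∑ j, eigval H x j = ∑ j, ker H (x j) (x j) / n := by
    have := (gram_isHermitian H x).trace_eq_sum_eigenvalues
    simpa [Matrix.trace, gram, eigval] using this.symm
  calc eigval H x i ≤ ∑ j, eigval H x j :=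
        Finset.single_le_sum (fun j _ => eigval_nonneg H x j) (Finset.mem_univ i)
    _ ≤ ∑ _j : Fin n, 1 / (n : ℝ) := by
        rw [h1]
        exact Finset.sum_le_sum fun j _ => div_le_div_of_nonneg_right (hker _) hn.le
    _ = 1 := by simp [hn.ne']

theorem feature_eq_zero {i : Fin n} (hi : eigval H x i = 0) : feature H x i = 0 := by
  have := norm_feature_sq H x i
  rw [hi, mul_zero] at this
  exact norm_eq_zero.1 (pow_eq_zero_iff two_ne_zero |>.1 this)

/-- The combination of the features with prescribed coefficients. -/
noncomputable def interpolant (b : Fin n → ℝ) : H :=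
  ∑ i, (b i / (n * eigval H x i)) • feature H x i

theorem coef_interpolant {b : Fin n → ℝ} (hb : ∀ i, eigval H x i = 0 → b i = 0) (i : Fin n) :
    coef H x (fun j => interpolant H x b (x j)) i = b i := by
  have hn : (n : ℝ) ≠ 0 := by exact_mod_cast (Fin.pos i).ne'
  rw [← inner_feature, interpolant, sum_inner]
  simp only [inner_smul_left, inner_feature_feature, conj_trivial]
  simp only [mul_ite, mul_zero, Finset.sum_ite_eq', Finset.mem_univ, if_true]
  by_cases h0 : eigval H x i = 0
  · simp [h0, hb i h0]
  · field_simp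

theorem norm_interpolant_sq (b : Fin n → ℝ) :
    ‖interpolant H x b‖ ^ 2 = ∑ i, b i ^ 2 / (n * eigval H x i) := by
  rw [← real_inner_self_eq_norm_sq, interpolant, sum_inner]
  refine Finset.sum_congr rfl fun i _ => ?_
  rw [inner_sum]
  simp only [inner_smul_left, inner_smul_right, inner_feature_feature, conj_trivial]
  simp only [mul_ite, mul_zero, Finset.sum_ite_eq, Finset.mem_univ, if_true]
  rcases eq_or_ne ((n : ℝ) * eigval H x i) 0 with h0 | h0
  · simp [h0]
  · field_simp

/-- Bessel's inequality for the orthogonal features: the inner product of `f` with its interpolant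
equals the squared norm `S` of the interpolant, and Cauchy–Schwarz gives `S ≤ ‖f‖ ^ 2`. Null
directions contribute zero since division by zero is zero. -/
theorem sum_coef_sq_div_le (f : H) :
    ∑ i, coef H x (fun j => f (x j)) i ^ 2 / (n * eigval H x i) ≤ ‖f‖ ^ 2 := by
  set b := coef H x fun j => f (x j)
  set S := ∑ i, b i ^ 2 / (n * eigval H x i) with hS
  have h1 : inner ℝ f (interpolant H x b) = S := by
    rw [interpolant, inner_sum, hS]
    refine Finset.sum_congr rfl fun i _ => ?_
    rw [inner_smul_right, inner_feature]
    ring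
  have h2 := norm_interpolant_sq H x b
  rw [← hS] at h2
  have h3 := real_inner_le_norm f (interpolant H x b)
  nlinarith [sq_nonneg (‖f‖ - ‖interpolant H x b‖)]

theorem memEllipsoid_coef {σ R : ℝ} (hσ : 0 < σ) {f : H} (hf : ‖f‖ ≤ R) :
    MemEllipsoid (fun i => coef H x (fun j => f (x j)) i / σ) (eigval H x)
      (n * R ^ 2 / σ ^ 2) := by
  refine ⟨fun i hi => ?_, ?_⟩
  · rw [← inner_feature, feature_eq_zero H x hi]; simp
  · have h1 : ∀ i, (coef H x (fun j => f (x j)) i / σ) ^ 2 / eigval H x i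
        = n / σ ^ 2 * (coef H x (fun j => f (x j)) i ^ 2 / (n * eigval H x i)) := fun i => by
      have hn : (n : ℝ) ≠ 0 := by exact_mod_cast (Fin.pos i).ne'
      rcases eq_or_ne (eigval H x i) 0 with h0 | h0
      · simp [h0]
      · field_simp
    simp only [h1, ← Finset.mul_sum]
    calc n / σ ^ 2 * ∑ i, coef H x (fun j => f (x j)) i ^ 2 / (n * eigval H x i)
        ≤ n / σ ^ 2 * R ^ 2 := by
          gcongr
          exact (sum_coef_sq_div_le H x f).trans (pow_le_pow_left₀ (norm_nonneg _) hf 2)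
      _ = _ := by ring

theorem empNormSq_eq (h : X → ℝ) :
    empNormSq x h = (1 / (n : ℝ)) * ∑ i, coef H x (fun j => h (x j)) i ^ 2 := by
  rw [empNormSq, sum_coef_sq]

theorem spectralEstimator_eq (g : ℝ → ℝ → ℝ) (lam : ℝ → ℝ) (t : ℝ) (y : Fin n → ℝ) (z : X) :
    spectralEstimator H x g lam t y z
      = (1 / (n : ℝ)) * ∑ i, filterAt g lam t (eigval H x i) * coef H x y i * feature H x i z := by
  rw [spectralEstimator]
  simp only [Finset.sum_mul, feature_apply, Finset.mul_sum]
  rw [Finset.sum_comm]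
  exact Finset.sum_congr rfl fun i _ => Finset.sum_congr rfl fun j _ => by ring

theorem coef_spectralEstimator (g : ℝ → ℝ → ℝ) (lam : ℝ → ℝ) (t : ℝ) (y : Fin n → ℝ) (l : Fin n) :
    coef H x (fun j => spectralEstimator H x g lam t y (x j)) l
      = shrinkage g lam t (eigval H x l) * coef H x y l := by
  have hn : (n : ℝ) ≠ 0 := by exact_mod_cast (Fin.pos l).ne'
  have h1 : ∀ j, eigvec H x l j * spectralEstimator H x g lam t y (x j)
      = ∑ i, shrinkage g lam t (eigval H x i) * coef H x y i *
        (eigvec H x i j * eigvec H x l j) := fun j => by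
    rw [spectralEstimator_eq, Finset.mul_sum, Finset.mul_sum]
    refine Finset.sum_congr rfl fun i _ => ?_
    rw [feature_apply_design, shrinkage]
    field_simp
  rw [coef, Finset.sum_congr rfl fun j _ => h1 j, Finset.sum_comm]
  simp only [← Finset.mul_sum, sum_eigvec_mul_eigvec]
  simp

/-- The decay hypothesis makes the first `rank` sorted eigenvalues positive. The rank counts the
nonzero eigenvalues, so the remaining ones vanish. -/
theorem isPolySpectrum_eigval {c C β : ℝ} (hc : 0 < c) (h : PolyDecay H x c C β) :
    ∃ p : Fin n → ℕ, IsPolySpectrum (eigval H x) p (gram H x).rank c C β := by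
  set e : Fin n ≃ Fin (Fintype.card (Fin n)) :=
    (Fintype.equivOfCardEq (Fintype.card_fin _)).symm with he
  have hev : ∀ i, eigval H x i = (gram_isHermitian H x).eigenvalues₀ (e i) := fun i => rfl
  have hrn : (gram H x).rank ≤ n := by simpa using (gram H x).rank_le_card_width
  have hsub : (Finset.univ.filter fun i => (e i : ℕ) < (gram H x).rank)
      ⊆ Finset.univ.filter fun i => eigval H x i ≠ 0 := by
    intro i hi
    simp only [Finset.mem_filter, Finset.mem_univ, true_and] at hi ⊢
    have := (h (e i) hi).1
    rw [hev]
    exact (lt_of_lt_of_le (by positivity) this).ne'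
  have hsurj : ∀ k < (gram H x).rank, ∃ i, (e i : ℕ) = k := fun k hk =>
    ⟨e.symm ⟨k, by simpa using hk.trans_le hrn⟩, by simp⟩
  have hcard : (gram H x).rank ≤ (Finset.univ.filter fun i => (e i : ℕ) < (gram H x).rank).card := by
    have h1 : Finset.range (gram H x).rank
        ⊆ (Finset.univ.filter fun i => (e i : ℕ) < (gram H x).rank).image fun i => (e i : ℕ) := by
      intro k hk
      obtain ⟨i, rfl⟩ := hsurj k (Finset.mem_range.1 hk)
      exact Finset.mem_image_of_mem (fun i => (e i : ℕ)) (by simpa using hk)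
    simpa using (Finset.card_le_card h1).trans Finset.card_image_le
  have heq := Finset.eq_of_subset_of_card_le hsub (by
    refine le_trans (le_of_eq ?_) hcard
    rw [(gram_isHermitian H x).rank_eq_card_non_zero_eigs, Fintype.card_subtype]
    rfl)
  refine ⟨fun i => e i, fun i j hij => e.injective (Fin.ext hij), hsurj, fun i hi => ?_,
    fun i hi => ?_, fun i hi => ?_⟩
  · exact (h (e i) hi).1
  · exact (h (e i) hi).2
  · by_contra h0
    have : i ∈ Finset.univ.filter fun i => eigval H x i ≠ 0 := by simpa using h0
    rw [← heq] at this
    simp at this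
    omega

end Design

/-! ### Regularity of the filter and of the stopping rule -/

section Design

variable {X : Type u} (H : Type v) [NormedAddCommGroup H] [InnerProductSpace ℝ H]
  [CompleteSpace H] [RKHS ℝ H X ℝ] {n : ℕ} (x : Fin n → X)

theorem shrinkage_of_nonpos (g : ℝ → ℝ → ℝ) (lam : ℝ → ℝ) {t : ℝ} (ht : t ≤ 0) (ξ : ℝ) :
    shrinkage g lam t ξ = 0 := by
  simp [shrinkage, filterAt, not_lt.2 ht]

theorem shrinkage_of_pos (g : ℝ → ℝ → ℝ) (lam : ℝ → ℝ) {t : ℝ} (ht : 0 < t) (ξ : ℝ) :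
    shrinkage g lam t ξ = ξ * g (lam t) ξ := by
  simp [shrinkage, filterAt, ht]

variable {H x} {g : ℝ → ℝ → ℝ} {lam : ℝ → ℝ} {B D nu : ℝ} {Cq : ℝ → ℝ} {a η : ℝ}

theorem ShrinkageBounds.nonneg (h : ShrinkageBounds H x g lam a η) (ha : 0 ≤ a) (hη : 0 ≤ η)
    (t : ℝ) (i : Fin n) : 0 ≤ shrinkage g lam t (eigval H x i) := by
  rcases le_or_gt t 0 with ht | ht
  · rw [shrinkage_of_nonpos g lam ht]
  · have := eigval_nonneg H x i
    exact le_trans (by positivity) (h t ht i).1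

theorem ShrinkageBounds.le_one (h : ShrinkageBounds H x g lam a η) (t : ℝ) (i : Fin n) :
    shrinkage g lam t (eigval H x i) ≤ 1 := by
  rcases le_or_gt t 0 with ht | ht
  · rw [shrinkage_of_nonpos g lam ht]; exact zero_le_one
  · exact (h t ht i).2.trans (min_le_left _ _)

theorem monotone_shrinkage (hker : ∀ z : X, ker H z z ≤ 1) (hg : IsSpectralFilter g B D nu Cq)
    (hlam : IsTimeSchedule lam) (h : ShrinkageBounds H x g lam a η) (ha : 0 ≤ a) (hη : 0 ≤ η)
    (i : Fin n) : Monotone fun t => shrinkage g lam t (eigval H x i) := by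
  intro s t hst
  rcases le_or_gt s 0 with hs | hs
  · beta_reduce
    rw [shrinkage_of_nonpos g lam hs]
    exact h.nonneg ha hη t i
  · have ht : 0 < t := hs.trans_le hst
    beta_reduce
    rw [shrinkage_of_pos g lam hs, shrinkage_of_pos g lam ht]
    rcases (eigval_nonneg H x i).eq_or_lt with h0 | h0
    · simp [← h0]
    · refine mul_le_mul_of_nonneg_left ?_ h0.le
      exact hg.antitoneOn _ ⟨h0, eigval_le_one H x hker i⟩ (hlam.pos t ht) (hlam.pos s hs)
        (hlam.antitoneOn hs ht hst)

/-- Right-continuity makes the infimum in the stopping rule satisfy its own inequality. At time zero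
it comes from the upper bound `η * t * μ i`. -/
theorem tendsto_shrinkage_nhdsGT (hker : ∀ z : X, ker H z z ≤ 1)
    (hg : IsSpectralFilter g B D nu Cq) (hlam : IsTimeSchedule lam)
    (h : ShrinkageBounds H x g lam a η) (ha : 0 ≤ a) (hη : 0 ≤ η) {t : ℝ} (ht : 0 ≤ t)
    (i : Fin n) : Tendsto (fun s => shrinkage g lam s (eigval H x i)) (𝓝[>] t)
      (𝓝 (shrinkage g lam t (eigval H x i))) := by
  rcases ht.eq_or_lt with rfl | ht
  · rw [shrinkage_of_nonpos g lam le_rfl]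
    have h1 : Tendsto (fun s : ℝ => η * s * eigval H x i) (𝓝[>] 0) (𝓝 0) := by
      have : Tendsto (fun s : ℝ => η * s * eigval H x i) (𝓝 0) (𝓝 (η * 0 * eigval H x i)) :=
        Continuous.tendsto (by fun_prop) 0
      rw [mul_zero, zero_mul] at this
      exact this.mono_left nhdsWithin_le_nhds
    refine tendsto_of_tendsto_of_tendsto_of_le_of_le' tendsto_const_nhds h1 ?_ ?_
    · exact Eventually.of_forall fun s => h.nonneg ha hη s i
    · filter_upwards [self_mem_nhdsWithin] with s hs
      exact (h s hs i).2.trans (min_le_right _ _)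
  · rcases (eigval_nonneg H x i).eq_or_lt with h0 | h0
    · simp [← h0, shrinkage]
    · have hcont : ContinuousOn (fun s => eigval H x i * g (lam s) (eigval H x i)) (Ioi 0) :=
        continuousOn_const.mul ((hg.continuousOn _ ⟨h0, eigval_le_one H x hker i⟩).comp
          hlam.continuousOn fun s hs => hlam.pos s hs)
      have h1 := (hcont.continuousAt (Ioi_mem_nhds ht)).tendsto
      rw [shrinkage_of_pos g lam ht]
      refine (h1.congr' ?_).mono_left nhdsWithin_le_nhds
      filter_upwards [Ioi_mem_nhds ht] with s hs
      rw [shrinkage_of_pos g lam hs]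

theorem tendsto_shrinkage_atTop (hker : ∀ z : X, ker H z z ≤ 1)
    (hg : IsSpectralFilter g B D nu Cq) (hlam : IsTimeSchedule lam) {i : Fin n}
    (hi : 0 < eigval H x i) :
    Tendsto (fun s => shrinkage g lam s (eigval H x i)) atTop (𝓝 1) := by
  have h1 : Tendsto lam atTop (𝓝[>] 0) := tendsto_nhdsWithin_iff.2 ⟨hlam.tendsto_zero, by
    filter_upwards [eventually_gt_atTop 0] with t ht using hlam.pos t ht⟩
  refine ((hg.tendsto_one _ ⟨hi, eigval_le_one H x hker i⟩).comp h1).congr' ?_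
  filter_upwards [eventually_gt_atTop 0] with t ht
  rw [shrinkage_of_pos g lam ht, Function.comp]

theorem isShrinkageFamily {p : Fin n → ℕ} {r : ℕ} {c C β : ℝ}
    (hμ : IsPolySpectrum (eigval H x) p r c C β) (hc : 0 < c) (hC : 0 < C) (hβ : 0 ≤ β) (ha : 0 < a)
    (hη : 0 < η) (hnu : 1 ≤ nu) (hker : ∀ z : X, ker H z z ≤ 1)
    (hg : IsSpectralFilter g B D nu Cq) (hlam : IsTimeSchedule lam)
    (h : ShrinkageBounds H x g lam a η) :
    IsShrinkageFamily (fun t i => shrinkage g lam t (eigval H x i)) (eigval H x) r a η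
      (|Cq 1| * (|B| * C / (a * min 1 c)) + 1) β where
  eta_pos := hη
  mono := monotone_shrinkage hker hg hlam h ha.le hη.le
  nonneg := h.nonneg ha.le hη.le
  le_one := h.le_one
  lower t ht i := (h t ht i).1
  upper t ht i := (h t ht i).2
  resid M hM hMr i := by
    have hM0 : (0 : ℝ) < M := by exact_mod_cast hM
    have hY : 0 < (M : ℝ) ^ (-β) := Real.rpow_pos_of_pos hM0 _
    have hmin : 0 < min 1 c := lt_min one_pos hc
    rcases (eigval_nonneg H x i).eq_or_lt with h0 | h0
    · rw [← h0, mul_zero]; positivity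
    set t := (M : ℝ) ^ β / η with ht
    have ht0 : 0 < t := div_pos (Real.rpow_pos_of_pos hM0 _) hη
    have hl0 := hlam.pos t ht0
    -- The order of `lam t` is not assumed; it is read off at the `M`-th eigenvalue (index `M - 1`).
    -- There the shrinkage is at least `a * min 1 c`, while `|g| ≤ |B| / lam t` and the eigenvalue
    -- is at most `C * M ^ (-β)`; hence `lam t` is at most of order `M ^ (-β)`. Qualification with
    -- exponent one then bounds every residual.
    obtain ⟨j, hj⟩ := hμ.surj (M - 1) (by omega)
    have hjr : p j < r := by omega
    have hj0 := hμ.pos hc hjr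
    have h1 := (h t ht0 j).1
    rw [ht, mul_div_cancel₀ _ hη.ne', ← ht, shrinkage_of_pos g lam ht0] at h1
    have h2 : min 1 c ≤ min 1 ((M : ℝ) ^ β * eigval H x j) :=
      hμ.le_min_one_mul hβ hc hjr (by exact_mod_cast (by omega : p j + 1 ≤ M))
    have h3 := (le_abs_self _).trans
      ((hg.abs_le _ hl0 _ ⟨hj0, eigval_le_one H x hker j⟩).trans
        (div_le_div_of_nonneg_right (le_abs_self B) hl0.le))
    have h4 : eigval H x j ≤ C * (M : ℝ) ^ (-β) := hμ.le_of_le hC.le hβ hM (by omega)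
    have h5 : a * min 1 c ≤ C * (M : ℝ) ^ (-β) * (|B| / lam t) := by
      calc a * min 1 c ≤ a * min 1 ((M : ℝ) ^ β * eigval H x j) := by gcongr
        _ ≤ eigval H x j * g (lam t) (eigval H x j) := h1
        _ ≤ eigval H x j * (|B| / lam t) := by gcongr
        _ ≤ _ := by gcongr
    have h6 : lam t ≤ |B| * C / (a * min 1 c) * (M : ℝ) ^ (-β) := by
      rw [mul_div_assoc', le_div_iff₀ hl0] at h5
      rw [div_mul_eq_mul_div, le_div_iff₀ (by positivity)]
      linarith
    have h7 := hg.qualification 1 ⟨one_pos, hnu⟩ _ hl0 _ ⟨h0, eigval_le_one H x hker i⟩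
    rw [Real.rpow_one, Real.rpow_one] at h7
    calc (1 - shrinkage g lam t (eigval H x i)) * eigval H x i
        ≤ |1 - eigval H x i * g (lam t) (eigval H x i)| * eigval H x i := by
          rw [shrinkage_of_pos g lam ht0]
          exact mul_le_mul_of_nonneg_right (le_abs_self _) h0.le
      _ ≤ |Cq 1| * lam t := h7.trans (mul_le_mul_of_nonneg_right (le_abs_self _) hl0.le)
      _ ≤ |Cq 1| * (|B| * C / (a * min 1 c) * (M : ℝ) ^ (-β)) := by gcongr
      _ ≤ _ := by rw [add_mul, mul_assoc]; linarith

/-- The assumptions on the filter, the schedule and the kernel under which the stopping rule is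
well behaved. -/
structure IsRegularFilter (H : Type v) [NormedAddCommGroup H] [InnerProductSpace ℝ H]
    [CompleteSpace H] [RKHS ℝ H X ℝ] (x : Fin n → X) (g : ℝ → ℝ → ℝ) (lam : ℝ → ℝ) : Prop where
  mono : ∀ i, Monotone fun t => shrinkage g lam t (eigval H x i)
  le_one : ∀ t i, shrinkage g lam t (eigval H x i) ≤ 1
  rightCont : ∀ t, 0 ≤ t → ∀ i, Tendsto (fun s => shrinkage g lam s (eigval H x i)) (𝓝[>] t)
      (𝓝 (shrinkage g lam t (eigval H x i)))
  tendsto_one : ∀ i, 0 < eigval H x i →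
    Tendsto (fun s => shrinkage g lam s (eigval H x i)) atTop (𝓝 1)

theorem isRegularFilter (ha : 0 ≤ a) (hη : 0 ≤ η) (hker : ∀ z : X, ker H z z ≤ 1)
    (hg : IsSpectralFilter g B D nu Cq) (hlam : IsTimeSchedule lam)
    (h : ShrinkageBounds H x g lam a η) : IsRegularFilter H x g lam where
  mono := monotone_shrinkage hker hg hlam h ha hη
  le_one := h.le_one
  rightCont _ ht := tendsto_shrinkage_nhdsGT hker hg hlam h ha hη ht
  tendsto_one _ hi := tendsto_shrinkage_atTop hker hg hlam hi

namespace IsRegularFilter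

variable {α σ : ℝ}

theorem antitone_smoothedRisk (h : IsRegularFilter H x g lam) (α : ℝ) (y : Fin n → ℝ) :
    Antitone fun t => smoothedRisk H x g lam α t y := by
  intro s t hst
  refine mul_le_mul_of_nonneg_left (Finset.sum_le_sum fun i _ => ?_) (by positivity)
  have h1 := h.mono i hst
  have h2 := h.le_one t i
  beta_reduce at h1
  refine mul_le_mul_of_nonneg_right (mul_le_mul_of_nonneg_left ?_
    (Real.rpow_nonneg (eigval_nonneg H x i) _)) (sq_nonneg _)
  exact pow_le_pow_left₀ (by linarith) (by linarith) 2

theorem tendsto_smoothedRisk (h : IsRegularFilter H x g lam) (α : ℝ) (y : Fin n → ℝ) {t : ℝ}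
    (ht : 0 ≤ t) : Tendsto (fun s => smoothedRisk H x g lam α s y) (𝓝[>] t)
      (𝓝 (smoothedRisk H x g lam α t y)) := by
  refine Tendsto.const_mul _ (tendsto_finsetSum _ fun i _ => ?_)
  exact (((tendsto_const_nhds.sub (h.rightCont t ht i)).pow 2).const_mul _).mul_const _

theorem exists_smoothedRisk_le (h : IsRegularFilter H x g lam) (hα : 0 < α) (hσ : 0 < σ)
    (y : Fin n → ℝ) : ∃ t, 0 < t ∧
      smoothedRisk H x g lam α t y ≤ σ ^ 2 * (∑ i, eigval H x i ^ α) / n := by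
  by_cases h0 : ∀ i, eigval H x i = 0
  · exact ⟨1, one_pos, by simp [smoothedRisk, h0, Real.zero_rpow hα.ne']⟩
  · push Not at h0
    obtain ⟨j, hj⟩ := h0
    have hn : (0 : ℝ) < n := by exact_mod_cast Fin.pos j
    have hpos : 0 < ∑ i, eigval H x i ^ α :=
      Finset.sum_pos' (fun i _ => Real.rpow_nonneg (eigval_nonneg H x i) _)
        ⟨j, Finset.mem_univ j,
          Real.rpow_pos_of_pos (lt_of_le_of_ne (eigval_nonneg H x j) hj.symm) _⟩
    have hlim : Tendsto (fun s => smoothedRisk H x g lam α s y) atTop (𝓝 0) := by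
      have : Tendsto (fun s => smoothedRisk H x g lam α s y) atTop
          (𝓝 ((1 / (n : ℝ)) * ∑ _i : Fin n, 0)) := by
        refine Tendsto.const_mul _ (tendsto_finsetSum _ fun i _ => ?_)
        rcases (eigval_nonneg H x i).eq_or_lt with hi | hi
        · simp [← hi, Real.zero_rpow hα.ne']
        · have := (((tendsto_const_nhds (x := (1 : ℝ))).sub (h.tendsto_one i hi)).pow 2).const_mul
            (eigval H x i ^ α) |>.mul_const (coef H x y i ^ 2)
          simpa using this
      simpa using this
    obtain ⟨t, ht1, ht2⟩ := ((eventually_gt_atTop 0).and (hlim.eventually (gt_mem_nhds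
      (show 0 < σ ^ 2 * (∑ i, eigval H x i ^ α) / n by positivity)))).exists
    exact ⟨t, ht1, ht2.le⟩

theorem stoppingTime_nonneg (σ α : ℝ) (y : Fin n → ℝ) : 0 ≤ stoppingTime H x g lam σ α y :=
  Real.sInf_nonneg fun _ ht => ht.1.le

theorem stoppingTime_lt_iff (h : IsRegularFilter H x g lam) (hα : 0 < α) (hσ : 0 < σ)
    (y : Fin n → ℝ) (s : ℝ) : stoppingTime H x g lam σ α y < s ↔
      ∃ t, (0 < t ∧ smoothedRisk H x g lam α t y ≤ σ ^ 2 * (∑ i, eigval H x i ^ α) / n) ∧ t < s :=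
  csInf_lt_iff ⟨0, fun _ ht => ht.1.le⟩ (h.exists_smoothedRisk_le hα hσ y)

theorem smoothedRisk_le_of_lt (h : IsRegularFilter H x g lam) (hα : 0 < α) (hσ : 0 < σ)
    (y : Fin n → ℝ) {s : ℝ} (hs : stoppingTime H x g lam σ α y < s) :
    smoothedRisk H x g lam α s y ≤ σ ^ 2 * (∑ i, eigval H x i ^ α) / n := by
  obtain ⟨t, ⟨_, ht⟩, hts⟩ := (h.stoppingTime_lt_iff hα hσ y s).1 hs
  exact (h.antitone_smoothedRisk α y hts.le).trans ht

theorem smoothedRisk_stoppingTime_le (h : IsRegularFilter H x g lam) (hα : 0 < α) (hσ : 0 < σ)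
    (y : Fin n → ℝ) : smoothedRisk H x g lam α (stoppingTime H x g lam σ α y) y
      ≤ σ ^ 2 * (∑ i, eigval H x i ^ α) / n := by
  refine le_of_tendsto (h.tendsto_smoothedRisk α y (stoppingTime_nonneg σ α y)) ?_
  filter_upwards [self_mem_nhdsWithin] with s hs
  exact h.smoothedRisk_le_of_lt hα hσ y hs

theorem lt_smoothedRisk {y : Fin n → ℝ} {t : ℝ} (ht : 0 < t)
    (htτ : t < stoppingTime H x g lam σ α y) :
    σ ^ 2 * (∑ i, eigval H x i ^ α) / n < smoothedRisk H x g lam α t y := by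
  by_contra hle
  exact notMem_of_lt_csInf htτ ⟨0, fun _ ht => ht.1.le⟩ ⟨ht, not_lt.1 hle⟩

theorem smoothedRisk_synth (t : ℝ) (w : Fin n → ℝ) :
    smoothedRisk H x g lam α t (synth H x σ w) = σ ^ 2 * (∑ i, eigval H x i ^ α *
      (1 - shrinkage g lam t (eigval H x i)) ^ 2 * w i ^ 2) / n := by
  rw [smoothedRisk, Finset.mul_sum, Finset.mul_sum, Finset.sum_div]
  refine Finset.sum_congr rfl fun i _ => ?_
  rw [coef_synth]
  ring

theorem isStoppingRule (h : IsRegularFilter H x g lam) (hα : 0 < α) (hσ : 0 < σ) :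
    IsStoppingRule (fun t i => shrinkage g lam t (eigval H x i)) (eigval H x) α
      fun w => stoppingTime H x g lam σ α (synth H x σ w) where
  risk_le w := by
    have h1 := h.smoothedRisk_stoppingTime_le hα hσ (synth H x σ w)
    rw [smoothedRisk_synth] at h1
    rcases Nat.eq_zero_or_pos n with rfl | hn
    · simp
    · have hn : (0 : ℝ) < n := by exact_mod_cast hn
      exact le_of_mul_le_mul_left ((div_le_div_iff_of_pos_right hn).1 h1) (by positivity)
  lt_risk w t ht htτ := by
    have h1 := lt_smoothedRisk ht htτ
    rw [smoothedRisk_synth] at h1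
    rcases Nat.eq_zero_or_pos n with rfl | hn
    · simp at h1
    · have hn : (0 : ℝ) < n := by exact_mod_cast hn
      exact lt_of_mul_lt_mul_left ((div_lt_div_iff_of_pos_right hn).1 h1) (by positivity)

theorem measurable_coef (i : Fin n) : Measurable fun y => coef H x y i := by
  unfold coef
  fun_prop

/-- The smoothed risk is antitone in time, so a stopping time below `s` is detected at a rational
time. -/
theorem measurable_stoppingTime (h : IsRegularFilter H x g lam) (hα : 0 < α) (hσ : 0 < σ) :
    Measurable (stoppingTime H x g lam σ α) := by
  refine measurable_of_Iio fun s => ?_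
  have h1 : stoppingTime H x g lam σ α ⁻¹' Iio s = ⋃ q : ℚ, {y | (0 < (q : ℝ) ∧ (q : ℝ) < s) ∧
      smoothedRisk H x g lam α q y ≤ σ ^ 2 * (∑ i, eigval H x i ^ α) / n} := by
    ext y
    simp only [mem_preimage, mem_Iio, mem_iUnion, mem_ofPred_eq]
    constructor
    · intro hy
      obtain ⟨q, hq1, hq2⟩ := exists_rat_btwn hy
      exact ⟨q, ⟨(stoppingTime_nonneg σ α y).trans_lt hq1, hq2⟩,
        h.smoothedRisk_le_of_lt hα hσ y hq1⟩
    · rintro ⟨q, ⟨hq1, hq2⟩, hq3⟩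
      exact (h.stoppingTime_lt_iff hα hσ y s).2 ⟨q, ⟨hq1, hq3⟩, hq2⟩
  rw [h1]
  refine MeasurableSet.iUnion fun q => (MeasurableSet.const _).inter ?_
  have hmeas : Measurable fun y => smoothedRisk H x g lam α q y :=
    Measurable.const_mul (Finset.measurable_sum _ fun i _ =>
      ((measurable_coef i).pow_const 2).const_mul _) _
  exact measurableSet_le hmeas measurable_const

/-- The filter is written as shrinkage divided by eigenvalue, since shrinkage is monotone, hence
measurable, in time. At zero eigenvalues, where `g` is arbitrary, the feature vanishes. -/
theorem measurable_stoppedEstimator (h : IsRegularFilter H x g lam) (hα : 0 < α) (hσ : 0 < σ) :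
    Measurable (stoppedEstimator H x g lam σ α) := by
  refine measurable_pi_lambda _ fun z => ?_
  have h1 : ∀ y, stoppedEstimator H x g lam σ α y z = (1 / (n : ℝ)) * ∑ i,
      shrinkage g lam (stoppingTime H x g lam σ α y) (eigval H x i) / eigval H x i
        * coef H x y i * feature H x i z := fun y => by
    rw [stoppedEstimator, spectralEstimator_eq]
    congr 1
    refine Finset.sum_congr rfl fun i _ => ?_
    rcases eq_or_ne (eigval H x i) 0 with h0 | h0
    · simp [feature_eq_zero H x h0]
    · rw [shrinkage, mul_div_cancel_left₀ _ h0]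
  simp only [h1]
  refine Measurable.const_mul (Finset.measurable_sum _ fun i _ => ?_) _
  exact ((((h.mono i).measurable.comp (h.measurable_stoppingTime hα hσ)).div_const _).mul
    (measurable_coef i)).mul_const _

end IsRegularFilter

/-- An inequality suffices for the upper bound, and `lintegral_map_le` then asks for no
measurability. -/
theorem risk_stoppedEstimator_le {α σ : ℝ} (hσ : 0 < σ) (f : H) :
    risk x σ (stoppedEstimator H x g lam σ α) f ≤ ENNReal.ofReal (σ ^ 2 / n) *
      ∫⁻ z, ENNReal.ofReal (∑ i, (shrinkage g lam (stoppingTime H x g lam σ α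
        (synth H x σ fun j => coef H x (fun k => f (x k)) j / σ + z j)) (eigval H x i) *
        (coef H x (fun k => f (x k)) i / σ + z i) - coef H x (fun k => f (x k)) i / σ) ^ 2)
        ∂(stdNoise n) := by
  rw [risk, noise_eq_map H x, ← lintegral_const_mul' _ _ ENNReal.ofReal_ne_top]
  refine (lintegral_map_le _ _).trans (lintegral_mono fun z => ?_)
  rw [← ENNReal.ofReal_mul (by positivity)]
  refine le_of_eq (congrArg ENNReal.ofReal ?_)
  set θ : Fin n → ℝ := fun j => coef H x (fun k => f (x k)) j / σ with hθ
  have hy : (fun i => f (x i) + synth H x σ z i) = synth H x σ fun j => θ j + z j := by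
    rw [synth_add, hθ, synth_coef H x hσ.ne']
  rw [empNormSq_eq H x, hy, show σ ^ 2 / (n : ℝ) = 1 / n * σ ^ 2 by ring, mul_assoc]
  congr 1
  rw [Finset.mul_sum]
  refine Finset.sum_congr rfl fun i _ => ?_
  rw [coef_sub, stoppedEstimator, coef_spectralEstimator, coef_synth]
  have hcf : coef H x (fun k => f (x k)) i = σ * θ i := by
    rw [hθ]; field_simp
  have key : ∀ G : ℝ, (G * (σ * (θ i + z i)) - coef H x (fun k => f (x k)) i) ^ 2
      = σ ^ 2 * (G * (θ i + z i) - θ i) ^ 2 := fun G => by rw [hcf]; ring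
  exact key _

end Design

/-! ### Two-point and cube lower bounds -/

section TwoPoint

/-- A common lower bound for the densities on `[-1, 1]` of the unit Gaussians centred in there. -/
noncomputable def gaussianFloor : ℝ := (√(2 * Real.pi))⁻¹ * Real.exp (-2)

theorem gaussianFloor_pos : 0 < gaussianFloor := by
  unfold gaussianFloor
  positivity

theorem gaussianFloor_smul_le {m : ℝ} (hm : |m| ≤ 1) :
    ENNReal.ofReal gaussianFloor • (volume.restrict (Icc (-1 : ℝ) 1)) ≤ gaussianReal m 1 := by
  rw [gaussianReal_of_var_ne_zero _ one_ne_zero, ← withDensity_const,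
    ← withDensity_indicator measurableSet_Icc]
  refine withDensity_mono (ae_of_all _ fun v => ?_)
  by_cases hv : v ∈ Icc (-1 : ℝ) 1
  · rw [indicator_of_mem hv, gaussianPDF]
    refine ENNReal.ofReal_le_ofReal ?_
    rw [gaussianPDFReal, gaussianFloor]
    simp only [NNReal.coe_one, mul_one]
    refine mul_le_mul_of_nonneg_left (Real.exp_le_exp.2 ?_) (by positivity)
    obtain ⟨h1, h2⟩ := abs_le.1 hm
    have h3 : (v - m) ^ 2 ≤ 2 ^ 2 := sq_le_sq' (by linarith [hv.1]) (by linarith [hv.2])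
    linarith
  · rw [indicator_of_notMem hv]; exact zero_le

theorem lintegral_gaussian_add (m : ℝ) {F : ℝ → ℝ≥0∞} (hF : Measurable F) :
    ∫⁻ u, F (m + u) ∂(gaussianReal 0 1) = ∫⁻ v, F v ∂(gaussianReal m 1) := by
  have h := gaussianReal_map_const_add (μ := 0) (v := 1) m
  rw [zero_add] at h
  rw [← h, lintegral_map hF (by fun_prop)]

/-- Both laws dominate `gaussianFloor` times Lebesgue measure on `[-1, 1]`, of length two, and `(d -
h) ^ 2 + (d + h) ^ 2 ≥ 2 h ^ 2` there. -/
theorem two_point_bound {h : ℝ} (hh0 : 0 ≤ h) (hh : h ≤ 1) {d : ℝ → ℝ} (hd : Measurable d) :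
    ENNReal.ofReal (4 * gaussianFloor * h ^ 2) ≤
      ∫⁻ u, ENNReal.ofReal ((d (h + u) - h) ^ 2) ∂(gaussianReal 0 1)
        + ∫⁻ u, ENNReal.ofReal ((d (-h + u) - -h) ^ 2) ∂(gaussianReal 0 1) := by
  have hm1 : Measurable fun v => ENNReal.ofReal ((d v - h) ^ 2) := by fun_prop
  have hm2 : Measurable fun v => ENNReal.ofReal ((d v - -h) ^ 2) := by fun_prop
  rw [lintegral_gaussian_add h hm1, lintegral_gaussian_add (-h) hm2]
  have h1 := gaussianFloor_smul_le (m := h) (abs_le.2 ⟨by linarith, hh⟩)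
  have h2 := gaussianFloor_smul_le (m := -h) (abs_le.2 ⟨by linarith, by linarith⟩)
  refine le_trans ?_ (add_le_add (lintegral_mono' h1 le_rfl) (lintegral_mono' h2 le_rfl))
  rw [← lintegral_add_left hm1, lintegral_smul_measure]
  calc ENNReal.ofReal (4 * gaussianFloor * h ^ 2)
      = ENNReal.ofReal gaussianFloor •
        ∫⁻ _v, ENNReal.ofReal (2 * h ^ 2) ∂(volume.restrict (Icc (-1 : ℝ) 1)) := by
        rw [lintegral_const, Measure.restrict_apply_univ, Real.volume_Icc, smul_eq_mul,
          ← ENNReal.ofReal_mul (by positivity), ← ENNReal.ofReal_mul gaussianFloor_pos.le]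
        congr 1
        ring
    _ ≤ _ := by
        refine mul_le_mul' le_rfl ?_
        refine lintegral_mono fun v => ?_
        rw [← ENNReal.ofReal_add (sq_nonneg _) (sq_nonneg _)]
        refine ENNReal.ofReal_le_ofReal ?_
        nlinarith [sq_nonneg (d v)]

theorem lintegral_stdNoise_insertNth {n : ℕ} (i : Fin (n + 1)) {F : (Fin (n + 1) → ℝ) → ℝ≥0∞}
    (hF : Measurable F) : ∫⁻ z, F z ∂(stdNoise (n + 1))
      = ∫⁻ w, ∫⁻ u, F (i.insertNth u w) ∂(gaussianReal 0 1) ∂(stdNoise n) := by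
  have hmp := (measurePreserving_piFinSuccAbove (fun _ : Fin (n + 1) => gaussianReal 0 1) i).symm
  have h1 := hmp.lintegral_comp hF
  exact h1.symm.trans (lintegral_prod_symm' _ (hF.comp hmp.measurable))

/-- Fubini: with all coordinates but the `i`-th frozen, the estimator is a function of one Gaussian
observation. -/
theorem two_point_bound_pi {n : ℕ} {h : ℝ} (hh0 : 0 ≤ h) (hh : h ≤ 1) (i : Fin n)
    {d : (Fin n → ℝ) → ℝ} (hd : Measurable d) (θ : Fin n → ℝ) :
    ENNReal.ofReal (4 * gaussianFloor * h ^ 2) ≤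
      ∫⁻ z, ENNReal.ofReal ((d (Function.update θ i h + z) - h) ^ 2) ∂(stdNoise n)
        + ∫⁻ z, ENNReal.ofReal ((d (Function.update θ i (-h) + z) - -h) ^ 2) ∂(stdNoise n) := by
  obtain ⟨n, rfl⟩ : ∃ k, n = k + 1 := ⟨n - 1, by have := Fin.pos i; omega⟩
  rw [lintegral_stdNoise_insertNth i (by fun_prop), lintegral_stdNoise_insertNth i (by fun_prop)]
  have hins : ∀ (s u : ℝ) (w : Fin n → ℝ), Function.update θ i s + i.insertNth u w
      = i.insertNth (α := fun _ => ℝ) (s + u) (fun j => θ (i.succAbove j) + w j) := by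
    intro s u w
    rw [Fin.eq_insertNth_iff]
    constructor
    · simp
    · ext j
      simp [Fin.removeNth]
  simp only [hins]
  have hmeas : ∀ s : ℝ, Measurable fun q : (Fin n → ℝ) × ℝ =>
      ENNReal.ofReal ((d (i.insertNth (α := fun _ => ℝ) (s + q.2)
        (fun j => θ (i.succAbove j) + q.1 j)) - s) ^ 2) := by
    intro s
    have h1 : Measurable fun q : (Fin n → ℝ) × ℝ =>
        i.insertNth (α := fun _ => ℝ) (s + q.2) (fun j => θ (i.succAbove j) + q.1 j) := by
      refine measurable_pi_lambda _ fun k => ?_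
      refine Fin.succAboveCases i ?_ (fun j => ?_) k
      · simp only [Fin.insertNth_apply_same]; fun_prop
      · simp only [Fin.insertNth_apply_succAbove]; fun_prop
    exact (((hd.comp h1).sub_const s).pow_const 2).ennreal_ofReal
  rw [← lintegral_add_left (hmeas h).lintegral_prod_right']
  calc ENNReal.ofReal (4 * gaussianFloor * h ^ 2)
      = ∫⁻ _w, ENNReal.ofReal (4 * gaussianFloor * h ^ 2) ∂(stdNoise n) := by simp
    _ ≤ _ := by
      refine lintegral_mono fun w => ?_
      refine two_point_bound hh0 hh (d := fun v => d (i.insertNth (α := fun _ => ℝ) v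
        (fun j => θ (i.succAbove j) + w j))) (hd.comp ?_)
      refine measurable_pi_lambda _ fun k => ?_
      refine Fin.succAboveCases i ?_ (fun j => ?_) k
      · simp only [Fin.insertNth_apply_same]; fun_prop
      · simp only [Fin.insertNth_apply_succAbove]; fun_prop

/-- The vertex of the cube `{-h, h} ^ J` selected by `s`. -/
def cubeVertex {n : ℕ} (J : Finset (Fin n)) (h : ℝ) (s : Fin n → Bool) (i : Fin n) : ℝ :=
  if i ∈ J then (if s i then h else -h) else 0

theorem cubeVertex_update {n : ℕ} {J : Finset (Fin n)} {i : Fin n} (hi : i ∈ J) (h : ℝ)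
    (s : Fin n → Bool) (b : Bool) : cubeVertex J h (Function.update s i b)
      = Function.update (cubeVertex J h s) i (if b then h else -h) := by
  ext j
  rcases eq_or_ne j i with rfl | hj
  · simp [cubeVertex, hi]
  · simp [cubeVertex, hj]

/-- Assouad's argument: for each coordinate in `J`, every vertex is paired with the one whose sign
there is flipped. Summing over all vertices counts each error twice, which halves the constant `4`.
-/
theorem card_mul_le_sum_cube {n : ℕ} {h : ℝ} (hh0 : 0 ≤ h) (hh : h ≤ 1) (J : Finset (Fin n))
    {d : (Fin n → ℝ) → Fin n → ℝ} (hd : Measurable d) :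
    (Fintype.card (Fin n → Bool) : ℝ≥0∞) * ENNReal.ofReal (2 * gaussianFloor * h ^ 2 * J.card) ≤
      ∑ s : Fin n → Bool, ∑ i ∈ J, ∫⁻ z,
        ENNReal.ofReal ((d (cubeVertex J h s + z) i - cubeVertex J h s i) ^ 2) ∂(stdNoise n) := by
  set T : (Fin n → Bool) → Fin n → ℝ≥0∞ := fun s i => ∫⁻ z,
    ENNReal.ofReal ((d (cubeVertex J h s + z) i - cubeVertex J h s i) ^ 2) ∂(stdNoise n) with hT
  have hpair : ∀ i ∈ J, ∀ s, ENNReal.ofReal (4 * gaussianFloor * h ^ 2)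
      ≤ T s i + T (Function.update s i (!s i)) i := by
    intro i hi s
    have h1 := two_point_bound_pi hh0 hh i ((measurable_pi_apply i).comp hd) (cubeVertex J h s)
    have h2 : ∀ b, T (Function.update s i b) i = ∫⁻ z, ENNReal.ofReal
        ((d (Function.update (cubeVertex J h s) i (if b then h else -h) + z) i
          - (if b then h else -h)) ^ 2) ∂(stdNoise n) := by
      intro b
      simp only [hT, cubeVertex_update hi, Function.update_self]
    have h3 : T s i = T (Function.update s i (s i)) i := by rw [Function.update_eq_self]
    rw [h3, h2, h2]
    cases s i
    · rw [add_comm]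
      simpa using h1
    · simpa using h1
  have hsum : ∀ i ∈ J, (Fintype.card (Fin n → Bool) : ℝ≥0∞) *
      ENNReal.ofReal (2 * gaussianFloor * h ^ 2) ≤ ∑ s, T s i := by
    intro i hi
    have hinv : Function.Involutive fun s : Fin n → Bool => Function.update s i (!s i) := by
      intro s; simp
    have h1 : ∑ s, T (Function.update s i (!s i)) i = ∑ s, T s i :=
      Equiv.sum_comp hinv.toPerm fun s => T s i
    have h2 := Finset.sum_le_sum fun s (_ : s ∈ Finset.univ) => hpair i hi s
    rw [Finset.sum_add_distrib, h1, Finset.sum_const, Finset.card_univ, nsmul_eq_mul, ← two_mul,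
      show 4 * gaussianFloor * h ^ 2 = 2 * (2 * gaussianFloor * h ^ 2) by ring,
      ENNReal.ofReal_mul zero_le_two, mul_left_comm] at h2
    rw [ENNReal.ofReal_ofNat] at h2
    exact (ENNReal.mul_le_mul_iff_right two_ne_zero ENNReal.ofNat_ne_top).1 h2
  rw [Finset.sum_comm]
  calc (Fintype.card (Fin n → Bool) : ℝ≥0∞) * ENNReal.ofReal (2 * gaussianFloor * h ^ 2 * J.card)
      = ∑ _i ∈ J, (Fintype.card (Fin n → Bool) : ℝ≥0∞) *
        ENNReal.ofReal (2 * gaussianFloor * h ^ 2) := by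
        rw [Finset.sum_const, nsmul_eq_mul,
          ENNReal.ofReal_mul (mul_nonneg (mul_nonneg zero_le_two gaussianFloor_pos.le)
            (sq_nonneg h)), ENNReal.ofReal_natCast]
        ring
    _ ≤ _ := Finset.sum_le_sum hsum

end TwoPoint

/-! ### Minimax lower bound over the ball -/

section Design

variable {X : Type u} {H : Type v} [NormedAddCommGroup H] [InnerProductSpace ℝ H]
  [CompleteSpace H] [RKHS ℝ H X ℝ] {n : ℕ} {x : Fin n → X}

theorem risk_interpolant {σ : ℝ} (hσ : 0 < σ) {est : (Fin n → ℝ) → X → ℝ} (hest : Measurable est)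
    {θ : Fin n → ℝ} (hθ : ∀ i, eigval H x i = 0 → θ i = 0) :
    risk x σ est (interpolant H x fun i => σ * θ i) = ENNReal.ofReal (σ ^ 2 / n) *
      ∫⁻ z, ENNReal.ofReal (∑ i, (coef H x (fun k => est (synth H x σ (θ + z)) (x k)) i / σ
        - θ i) ^ 2) ∂(stdNoise n) := by
  set f := interpolant H x fun i => σ * θ i with hf
  have hcf : ∀ i, coef H x (fun k => f (x k)) i = σ * θ i :=
    coef_interpolant H x fun i hi => by rw [hθ i hi, mul_zero]
  have hmeas : Measurable fun e : Fin n → ℝ => ENNReal.ofReal (empNormSq x fun z =>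
      est (fun i => f (x i) + e i) z - f z) := by
    unfold empNormSq
    refine (Measurable.const_mul (Finset.measurable_sum _ fun i _ => ?_) _).ennreal_ofReal
    have h1 : Measurable fun e : Fin n → ℝ => est (fun i => f (x i) + e i) (x i) :=
      (measurable_pi_apply (x i)).comp (hest.comp (by fun_prop))
    exact (h1.sub_const _).pow_const 2
  rw [risk, noise_eq_map H x, ← lintegral_const_mul' _ _ ENNReal.ofReal_ne_top,
    lintegral_map hmeas (measurable_synth H x σ)]
  refine lintegral_congr fun z => ?_
  rw [← ENNReal.ofReal_mul (by positivity)]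
  refine congrArg ENNReal.ofReal ?_
  have hy : (fun i => f (x i) + synth H x σ z i) = synth H x σ (θ + z) := by
    have h1 := synth_coef H x hσ.ne' fun i => f (x i)
    have h2 : (fun i => coef H x (fun k => f (x k)) i / σ) = θ := by
      ext i
      rw [hcf, mul_div_cancel_left₀ _ hσ.ne']
    rw [h2] at h1
    have h3 := synth_add H x σ θ z
    rw [h1] at h3
    exact h3.symm
  rw [empNormSq_eq H x, hy, show σ ^ 2 / (n : ℝ) = 1 / n * σ ^ 2 by ring, mul_assoc]
  congr 1
  rw [Finset.mul_sum]
  refine Finset.sum_congr rfl fun i _ => ?_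
  rw [coef_sub, hcf]
  field_simp

theorem exists_le_minimaxRisk {β c K : ℝ} (hβ : 0 ≤ β) (hc : 0 < c) (hK : 0 < K) :
    ∃ b > 0, ∀ {X : Type u} {H : Type v} [NormedAddCommGroup H] [InnerProductSpace ℝ H]
      [CompleteSpace H] [RKHS ℝ H X ℝ] {n : ℕ} {x : Fin n → X} {σ R C : ℝ} {p : Fin n → ℕ} {r : ℕ},
      0 < σ → 0 ≤ R → IsPolySpectrum (eigval H x) p r c C β → ∀ {m : ℕ}, m ≤ r →
      (m : ℝ) ^ (β + 1) ≤ K * (n * R ^ 2 / σ ^ 2) →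
      ENNReal.ofReal (b * (σ ^ 2 / n * m)) ≤ minimaxRisk H x σ R := by
  -- `h ≤ 1` keeps the means in the range of the two-point bound, and `h ^ 2 ≤ c / K` places every
  -- vertex of the cube in the ball of radius `R`.
  set h := min 1 √(c / K) with hh
  have hh0 : 0 < h := lt_min one_pos (Real.sqrt_pos.2 (by positivity))
  have hh1 : h ≤ 1 := min_le_left _ _
  have hh2 : h ^ 2 ≤ c / K := by
    rw [← Real.sq_sqrt (show 0 ≤ c / K by positivity)]
    exact pow_le_pow_left₀ hh0.le (min_le_right _ _) 2
  refine ⟨2 * gaussianFloor * h ^ 2, mul_pos (mul_pos two_pos gaussianFloor_pos) (by positivity), ?_⟩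
  intro X H _ _ _ _ n x σ R C p r hσ hR hμ m hmr hmK
  rcases Nat.eq_zero_or_pos m with rfl | hm
  · simp
  have hm0 : (0 : ℝ) < m := by exact_mod_cast hm
  have hn : 0 < n := by
    obtain ⟨i, _⟩ := hμ.surj 0 (by omega)
    exact Fin.pos i
  have hn : (0 : ℝ) < n := by exact_mod_cast hn
  set J : Finset (Fin n) := Finset.univ.filter fun i => p i < m with hJ
  have hJcard : (J.card : ℝ) = m := le_antisymm (hμ.card_low_le m) (hμ.card_low_ge hmr)
  have hJmem : ∀ {i}, i ∈ J ↔ p i < m := by simp [hJ]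
  have hsq : ∀ s i, cubeVertex J h s i ^ 2 = if i ∈ J then h ^ 2 else 0 := by
    intro s i
    unfold cubeVertex
    split_ifs <;> simp
  have hnorm : ∀ s, ‖interpolant H x fun i => σ * cubeVertex J h s i‖ ≤ R := by
    intro s
    refine le_of_sq_le_sq ?_ hR
    rw [norm_interpolant_sq]
    have h1 : ∀ i, (σ * cubeVertex J h s i) ^ 2 / (n * eigval H x i)
        ≤ if i ∈ J then σ ^ 2 * h ^ 2 / (n * c) * (m : ℝ) ^ β else 0 := by
      intro i
      rw [mul_pow, hsq]
      split_ifs with hi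
      · have hi' := hJmem.1 hi
        have h2 := hμ.low_rpow_ge hc hβ zero_le_one hi' (hi'.trans_le hmr)
        rw [Real.rpow_one, Real.rpow_one, mul_one, Real.rpow_neg hm0.le, ← div_eq_mul_inv] at h2
        calc σ ^ 2 * h ^ 2 / (n * eigval H x i) ≤ σ ^ 2 * h ^ 2 / (n * (c / (m : ℝ) ^ β)) := by
              gcongr
          _ = _ := by field_simp
      · simp
    refine (Finset.sum_le_sum fun i _ => h1 i).trans ?_
    rw [Finset.sum_ite_mem, Finset.univ_inter, Finset.sum_const, nsmul_eq_mul, hJcard]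
    have h3 : (m : ℝ) * (σ ^ 2 * h ^ 2 / (n * c) * (m : ℝ) ^ β)
        = σ ^ 2 / (n * c) * (h ^ 2 * (m : ℝ) ^ (β + 1)) := by
      rw [Real.rpow_add_one hm0.ne']; ring
    rw [h3]
    calc σ ^ 2 / (n * c) * (h ^ 2 * (m : ℝ) ^ (β + 1))
        ≤ σ ^ 2 / (n * c) * (c / K * (K * (n * R ^ 2 / σ ^ 2))) := by gcongr
      _ = R ^ 2 := by field_simp
  refine le_iInf₂ fun est hest => ?_
  have hest : Measurable est := hest
  set d : (Fin n → ℝ) → Fin n → ℝ := fun w i =>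
    coef H x (fun k => est (synth H x σ w) (x k)) i / σ with hd
  have hdm : Measurable d := by
    refine measurable_pi_lambda _ fun i => Measurable.div_const ?_ _
    unfold coef
    refine Finset.measurable_sum _ fun k _ => Measurable.const_mul ?_ _
    exact (measurable_pi_apply (x k)).comp (hest.comp (measurable_synth H x σ))
  have hrisk : ∀ s, ENNReal.ofReal (σ ^ 2 / n) * ∑ i ∈ J, ∫⁻ z,
      ENNReal.ofReal ((d (cubeVertex J h s + z) i - cubeVertex J h s i) ^ 2) ∂(stdNoise n)
      ≤ maxRisk H x σ R est := by
    intro s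
    refine le_trans ?_ (le_iSup₂_of_le (interpolant H x fun i => σ * cubeVertex J h s i)
      (hnorm s) le_rfl)
    rw [risk_interpolant hσ hest (fun i hi => ?_)]
    · refine mul_le_mul_right ?_ _
      rw [← lintegral_finsetSum _ fun i _ => ?_]
      · refine lintegral_mono fun z => ?_
        rw [← ENNReal.ofReal_sum_of_nonneg fun i _ => sq_nonneg _]
        exact ENNReal.ofReal_le_ofReal (Finset.sum_le_sum_of_subset_of_nonneg
          (Finset.subset_univ J) fun i _ _ => sq_nonneg _)
      · have h1 : Measurable fun z => d (cubeVertex J h s + z) i :=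
          (measurable_pi_apply i).comp (hdm.comp (measurable_const_add _))
        exact ((h1.sub_const _).pow_const 2).ennreal_ofReal
    · have : i ∉ J := fun hiJ => (hμ.pos hc ((hJmem.1 hiJ).trans_le hmr)).ne' hi
      simp [cubeVertex, this]
  have hsum := Finset.sum_le_sum fun s (_ : s ∈ Finset.univ) => hrisk s
  rw [← Finset.mul_sum, Finset.sum_const, Finset.card_univ, nsmul_eq_mul] at hsum
  have hcube := mul_le_mul_right (card_mul_le_sum_cube hh0.le hh1 J hdm) (ENNReal.ofReal (σ ^ 2 / n))
  have hfin := hcube.trans hsum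
  rw [hJcard, mul_left_comm, ← ENNReal.ofReal_mul (by positivity)] at hfin
  have hcard0 : (Fintype.card (Fin n → Bool) : ℝ≥0∞) ≠ 0 := by simp
  have := (ENNReal.mul_le_mul_iff_right hcard0 (ENNReal.natCast_ne_top _)).1 hfin
  refine le_trans (le_of_eq ?_) this
  congr 1
  ring

end Design

/-! ### Worst-case upper bound and conclusion -/

/-- The worst-case risk of the stopped estimator, in terms of an effective dimension `m`. -/
theorem exists_maxRisk_le {β α c C a B D nu : ℝ} {Cq : ℝ → ℝ} (hβ : 1 < β) (hα0 : 0 < α)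
    (hα2 : 1 < 2 * (β * α)) (hα1 : β * α < 1) (hc : 0 < c) (hC : 0 < C) (ha : 0 < a)
    (hnu : 1 ≤ nu) :
    ∃ κ > 0, ∃ K > 0, ∀ {X : Type u} {H : Type v} [NormedAddCommGroup H] [InnerProductSpace ℝ H]
      [CompleteSpace H] [RKHS ℝ H X ℝ] {n : ℕ} {x : Fin n → X} {σ R η : ℝ} {g : ℝ → ℝ → ℝ}
      {lam : ℝ → ℝ} {p : Fin n → ℕ} {r : ℕ},
      0 < σ → 0 < η → (∀ z : X, ker H z z ≤ 1) → IsSpectralFilter g B D nu Cq →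
      IsTimeSchedule lam → ShrinkageBounds H x g lam a η →
      IsPolySpectrum (eigval H x) p r c C β → ∀ {m : ℕ}, 1 ≤ m →
      κ * (n * R ^ 2 / σ ^ 2) ≤ (m : ℝ) ^ (β + 1) →
      maxRisk H x σ R (stoppedEstimator H x g lam σ α)
        ≤ ENNReal.ofReal (K * (σ ^ 2 / n * (min m r : ℕ))) := by
  have hmin : 0 < min 1 c := lt_min one_pos hc
  obtain ⟨κ, hκ, K, hK, hup⟩ := exists_loss_bound hβ hα0 hα2 hα1 hc hC ha
    (L := |Cq 1| * (|B| * C / (a * min 1 c)) + 1) (by positivity)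
  refine ⟨κ, hκ, K, hK, ?_⟩
  intro X H _ _ _ _ n x σ R η g lam p r hσ hη hker hg hlam hsb hμ m hm hκm
  have hγ := isShrinkageFamily hμ hc hC (by linarith) ha hη hnu hker hg hlam hsb
  have hτ := (isRegularFilter ha.le hη.le hker hg hlam hsb).isStoppingRule hα0 hσ
  refine iSup₂_le fun f hf => (risk_stoppedEstimator_le hσ f).trans ?_
  refine (mul_le_mul' le_rfl (hup hμ hγ (memEllipsoid_coef H x hσ hf) hτ hm hκm)).trans ?_
  rw [← ENNReal.ofReal_mul (by positivity)]
  refine ENNReal.ofReal_le_ofReal (le_of_eq ?_)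
  ring

end EarlyStopping

theorem corollary3 (β α c C a B D nu ρ : ℝ) (Cq : ℝ → ℝ)
    (hβ : 1 < β) (hα : α ∈ Set.Ico (1 / (β + 1)) (1 / β))
    (hc : 0 < c) (hcC : c ≤ C) (ha : a ∈ Set.Ioo (0 : ℝ) 1) (hnu : 1 ≤ nu) (hρ : 0 < ρ) :
    ∃ A b₁ b₂ : ℝ, 0 < A ∧ 0 < b₁ ∧ 0 < b₂ ∧
      ∀ (X : Type u) (H : Type v) [NormedAddCommGroup H] [InnerProductSpace ℝ H]
        [CompleteSpace H] [RKHS ℝ H X ℝ] (n : ℕ) (x : Fin n → X) (σ R η : ℝ)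
        (g : ℝ → ℝ → ℝ) (lam : ℝ → ℝ),
        0 < σ → 0 < R → 0 < η →
        (∀ z : X, EarlyStopping.ker H z z ≤ 1) →
        EarlyStopping.IsSpectralFilter g B D nu Cq →
        EarlyStopping.IsTimeSchedule lam →
        EarlyStopping.ShrinkageBounds H x g lam a η →
        EarlyStopping.PolyDecay H x c C β →
        ρ ≤ n * R ^ 2 / σ ^ 2 →
        (EarlyStopping.minimaxRisk H x σ R
            ≤ EarlyStopping.maxRisk H x σ R (EarlyStopping.stoppedEstimator H x g lam σ α) ∧
          EarlyStopping.maxRisk H x σ R (EarlyStopping.stoppedEstimator H x g lam σ α)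
            ≤ ENNReal.ofReal A * EarlyStopping.minimaxRisk H x σ R) ∧
        (ρ * (n * R ^ 2 / σ ^ 2) ≤ ((EarlyStopping.gram H x).rank : ℝ) ^ (β + 1) →
          ENNReal.ofReal (b₁ * (R ^ 2 * (σ ^ 2 / (R ^ 2 * n)) ^ (β / (β + 1))))
            ≤ EarlyStopping.minimaxRisk H x σ R ∧
          EarlyStopping.minimaxRisk H x σ R
            ≤ ENNReal.ofReal (b₂ * (R ^ 2 * (σ ^ 2 / (R ^ 2 * n)) ^ (β / (β + 1))))) := by
  have hβ0 : 0 < β + 1 := by linarith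
  have hα0 : 0 < α := lt_of_lt_of_le (by positivity) hα.1
  have hα1 : β * α < 1 := by
    have := hα.2
    rw [lt_div_iff₀ (by linarith)] at this
    linarith
  have hα2 : 1 < 2 * (β * α) := by
    have := hα.1
    rw [div_le_iff₀ hβ0] at this
    nlinarith
  have hC : 0 < C := hc.trans_le hcC
  obtain ⟨κ, hκ, K, hK, hup⟩ := EarlyStopping.exists_maxRisk_le.{u, v} (B := B) (D := D) (Cq := Cq)
    hβ hα0 hα2 hα1 hc hC ha.1 hnu
  set s := 1 / (β + 1) with hs
  have hs0 : 0 < s := by positivity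
  have hpow : ∀ y : ℝ, 0 ≤ y → (y ^ s) ^ (β + 1) = y := fun y hy => by
    rw [← Real.rpow_mul hy, hs, one_div_mul_cancel hβ0.ne', Real.rpow_one]
  -- A lower bound for `(κ * Q) ^ s`, available because `Q ≥ ρ`. It lets rounding up to an integer
  -- be absorbed in the factor `w = 1 + x₀⁻¹`; without such a bound on `Q` the rounding could
  -- dominate.
  set x₀ := (κ * ρ) ^ s with hx₀
  have hx₀pos : 0 < x₀ := by positivity
  set w := 1 + x₀⁻¹ with hw
  have hwpos : 0 < w := by positivity
  -- This `K` makes the lower bound apply at the very dimension `min m r` of the upper bound, so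
  -- that `A` is simply the ratio of the two constants.
  obtain ⟨b, hb, hlow⟩ := EarlyStopping.exists_le_minimaxRisk.{u, v} (β := β) (c := c)
    (K := w ^ (β + 1) * κ) (by linarith) hc (by positivity)
  refine ⟨K / b, b * min κ ρ ^ s, K * (w * κ ^ s), by positivity,
    mul_pos hb (Real.rpow_pos_of_pos (lt_min hκ hρ) _), by positivity, ?_⟩
  intro X H _ _ _ _ n x σ R η g lam hσ hR hη hker hg hlam hsb hpoly hρQ
  obtain ⟨p, hμ⟩ := EarlyStopping.isPolySpectrum_eigval H x hc hpoly
  set r := (EarlyStopping.gram H x).rank with hr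
  set Q := (n : ℝ) * R ^ 2 / σ ^ 2 with hQ
  have hQ0 : 0 < Q := hρ.trans_le hρQ
  have hn : (0 : ℝ) < n := by
    rcases Nat.eq_zero_or_pos n with rfl | hn
    · simp [hQ] at hQ0
    · exact_mod_cast hn
  set m := ⌈(κ * Q) ^ s⌉₊ with hm
  have hy0 : 0 < (κ * Q) ^ s := by positivity
  have hm1 : 1 ≤ m := Nat.ceil_pos.2 hy0
  have hym : (κ * Q) ^ s ≤ m := Nat.le_ceil _
  have hmw : (m : ℝ) ≤ w * (κ * Q) ^ s := by
    have h1 : x₀ ≤ (κ * Q) ^ s :=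
      Real.rpow_le_rpow (by positivity) (mul_le_mul_of_nonneg_left hρQ hκ.le) hs0.le
    have h2 : 1 ≤ x₀⁻¹ * (κ * Q) ^ s := by
      rw [← div_eq_inv_mul, le_div_iff₀ hx₀pos, one_mul]
      exact h1
    have h3 := (Nat.ceil_lt_add_one hy0.le).le
    rw [← hm] at h3
    rw [hw, add_mul, one_mul]
    linarith
  have hκm : κ * Q ≤ (m : ℝ) ^ (β + 1) := by
    rw [← hpow (κ * Q) (by positivity)]
    exact Real.rpow_le_rpow hy0.le hym hβ0.le
  have hmK : ((min m r : ℕ) : ℝ) ^ (β + 1) ≤ w ^ (β + 1) * κ * Q := by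
    calc ((min m r : ℕ) : ℝ) ^ (β + 1) ≤ (w * (κ * Q) ^ s) ^ (β + 1) := by
          refine Real.rpow_le_rpow (by positivity) (le_trans ?_ hmw) hβ0.le
          exact_mod_cast min_le_left m r
      _ = _ := by rw [Real.mul_rpow hwpos.le hy0.le, hpow _ (by positivity), mul_assoc]
  have hlower := hlow hσ hR.le hμ (min_le_right m r) hmK
  have hupper := hup (R := R) hσ hη hker hg hlam hsb hμ hm1 hκm
  have hle : EarlyStopping.minimaxRisk H x σ R
      ≤ EarlyStopping.maxRisk H x σ R (EarlyStopping.stoppedEstimator H x g lam σ α) :=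
    iInf₂_le _ ((EarlyStopping.isRegularFilter ha.1.le hη.le hker hg hlam
      hsb).measurable_stoppedEstimator hα0 hσ)
  -- Written through `Q`, the stated rate is `σ ^ 2 / n` times the effective dimension `Q ^ s`.
  have hrate : R ^ 2 * (σ ^ 2 / (R ^ 2 * n)) ^ (β / (β + 1)) = σ ^ 2 / n * Q ^ s := by
    have h1 : σ ^ 2 / (R ^ 2 * n) = Q⁻¹ := by rw [hQ, inv_div, mul_comm (R ^ 2)]
    have h2 : R ^ 2 = σ ^ 2 / n * Q := by rw [hQ]; field_simp
    have h3 : Q * Q ^ (-(β / (β + 1))) = Q ^ s := by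
      rw [mul_comm, ← Real.rpow_add_one hQ0.ne']
      congr 1
      rw [hs]
      field_simp
      ring
    rw [h1, Real.inv_rpow hQ0.le, ← Real.rpow_neg hQ0.le]
    conv_lhs => rw [h2]
    rw [mul_assoc, h3]
  refine ⟨⟨hle, hupper.trans ?_⟩, fun hrρ => ⟨le_trans ?_ hlower, hle.trans (hupper.trans ?_)⟩⟩
  · refine le_trans (le_of_eq ?_) (mul_le_mul' le_rfl hlower)
    rw [← ENNReal.ofReal_mul (by positivity)]
    congr 1
    field_simp
  · refine ENNReal.ofReal_le_ofReal ?_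
    rw [hrate]
    -- The side condition on the rank is used only here: it prevents `r` from truncating the
    -- effective dimension below the order `Q ^ s`.
    have h1 : min κ ρ ^ s * Q ^ s ≤ ((min m r : ℕ) : ℝ) := by
      have hmin0 : 0 < min κ ρ := lt_min hκ hρ
      rw [← Real.mul_rpow hmin0.le hQ0.le, Nat.cast_min]
      refine le_min (le_trans ?_ hym) ?_
      · exact Real.rpow_le_rpow (by positivity)
          (mul_le_mul_of_nonneg_right (min_le_left _ _) hQ0.le) hs0.le
      · have h2 : (r : ℝ) = ((r : ℝ) ^ (β + 1)) ^ s := by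
          rw [← Real.rpow_mul (by positivity), hs, mul_one_div_cancel hβ0.ne', Real.rpow_one]
        rw [h2]
        exact Real.rpow_le_rpow (by positivity)
          ((mul_le_mul_of_nonneg_right (min_le_right _ _) hQ0.le).trans hrρ) hs0.le
    calc b * min κ ρ ^ s * (σ ^ 2 / n * Q ^ s) = b * (σ ^ 2 / n * (min κ ρ ^ s * Q ^ s)) := by ring
      _ ≤ _ := by gcongr
  · refine ENNReal.ofReal_le_ofReal ?_
    rw [hrate]
    have h1 : ((min m r : ℕ) : ℝ) ≤ w * κ ^ s * Q ^ s := by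
      rw [mul_assoc, ← Real.mul_rpow hκ.le hQ0.le]
      exact le_trans (by exact_mod_cast min_le_left m r) hmw
    calc K * (σ ^ 2 / n * ((min m r : ℕ) : ℝ)) ≤ K * (σ ^ 2 / n * (w * κ ^ s * Q ^ s)) := by gcongr
      _ = _ := by ring
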